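/- Let $0<k<1$ and let $a,b,c\in\mathbb R$ satisfy $a-c=1$, $a-b=k^2$. Let $\mathrm{sn},\mathrm{cn},\mathrm{dn}$ denote the real Jacobi elliptic functions of modulus $k$ (with $\mathrm{ns}=1/\mathrm{sn}$, $\mathrm{dc}=\mathrm{dn}/\mathrm{cn}$, etc.). In Minkowski space $\mathbb R^{2,1}$ with coordinates $(x,y,z)$ and metric $\mathrm{diag}(1,1,-1)$, consider the system of confocal quadrics $$\frac{x^2}{\mu+a}+\frac{y^2}{\mu+b}-\frac{z^2}{\mu+c}=1,\qquad \mu\in\mathbb R\setminus\{-a,-b,-c\},\tag{1}$$ and the confocal coordinate system $$r(s_1,s_2,s_3)=\begin{pmatrix}\mathrm{sn}\,s_1\;\mathrm{dc}\,s_2\;\mathrm{ns}\,s_3\\ \mathrm{cn}\,s_1\;\mathrm{nc}\,s_2\;\mathrm{ds}\,s_3\\ \mathrm{dn}\,s_1\;\mathrm{sc}\,s_2\;\mathrm{cs}\,s_3\end{pmatrix},\qquad (s_1,s_2,s_3)\in D=\{\mathrm{cn}\,s_2\ne0,\ \mathrm{sn}\,s_3\neq 0\}.$$ Let $U\subset D$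 be the set where $k^2+(1-k^2)\,\mathrm{nc}^2 s_2\neq \mathrm{ns}^2 s_3$ (that is, where the confocal quadrics $s_2=\mathrm{const}$ and $s_3=\mathrm{const}$ through the point are distinct). Put $$\lambda_1=s_1+s_2+s_3,\quad \lambda_2=s_1+s_2-s_3,\quad \lambda_3=s_1-s_2+s_3,\quad \lambda_4=s_1-s_2-s_3,$$ and for $\lambda\in\mathbb R$ let $P_1(\lambda),\dots,P_4(\lambda)$ be the planes $$\begin{aligned}P_1:&\ \ x\,\mathrm{cn}\lambda-y\,\mathrm{sn}\lambda+z+\mathrm{dn}\lambda=0,&\quad P_2:&\ \ x\,\mathrm{cn}\lambda-y\,\mathrm{sn}\lambda+z-\mathrm{dn}\lambda=0,\\ P_3:&\ -x\,\mathrm{cn}\lambda+y\,\mathrm{sn}\lambda+z-\mathrm{dn}\lambda=0,&\quad P_4:&\ -x\,\mathrm{cn}\lambda+y\,\mathrm{sn}\lambda+z+\mathrm{dn}\lambda=0.\end{aligned}$$ Four one-parameter families of surfaces $\{\Sigma_1\},\dots,\{\Sigma_4\}$ in a nonempty open region $\Omega\subset\mathbb R^3$ form an *octahedral web* if each family smoothly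 foliates $\Omega$ (by the level surfaces of a smooth function without critical points), any three of these families define a coordinate system on $\Omega$ (the three functions are jointly injective with linearly independent differentials), and there are three further such foliations $\{\Sigma_{12}=\Sigma_{34}\}$, $\{\Sigma_{23}=\Sigma_{14}\}$, $\{\Sigma_{13}=\Sigma_{24}\}$ such that, for $i<j$, the intersection of any surface $\Sigma_i$ with any surface $\Sigma_j$ lies in a surface $\Sigma_{ij}$. **Theorem.** 1. Every point of $U$ has an open neighbourhood $V\subset U$ on which $r$ is injective. If $s\in D$, then $r(s)\in P_m(\lambda_m(s))$ for $m=1,\dots,4$. For every nonempty open $V\subset U$ on which $r$ is injective, the four families of surfaces $\{r(s): s\in V,\ \lambda_m(s)=\lambda\}$, $\lambda\in\mathbb R$, $m=1,\dots,4$, form an octahedral web in the open region $r(V)$, and each of these surfaces is a relatively open subset of the plane $P_m(\lambda)$. 2. For all $m$ and $\lambda$, the plane $P_m(\lambda)$ is tangent to every quadric of the confocal system (1) and meets the plane $z=0$ at a (Euclidean) angle of 45 degrees. 3. Let $\lambda_1+\lambda_4=\lambda_2+\lambda_3$ and put $s=\left(\frac{\lambda_1+\lambda_4}2,\frac{\lambda_1-\lambda_3}2,\frac{\lambda_1-\lambda_2}2\right)$.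 The four planes $P_m(\lambda_m)$ have a common point if and only if $s\in D$. In this case $r(s)$ is a common point and is the vertex of a circular cone touching the four planes; it is the only common point unless $\mathrm{sn}\,s_2=0$ and $\mathrm{cn}\,s_3=0$. 4. Let $\epsilon\in\{1,-1\}$ and $\lambda\in\mathbb R$. For each fixed $s_2$ with $\mathrm{sn}\,s_2\ne0$, $\mathrm{cn}\,s_2\neq0$, the curve $s_1+\epsilon s_3=\lambda$ (with $\mathrm{sn}\,s_3\ne 0$) is a straight line contained in the one-sheeted hyperboloid (1) with $\mu=-b+(b-c)\,\mathrm{nc}^2 s_2$ (an asymptotic line of it). As $s_2\to0$, for all $s_1,s_3$ with $\mathrm{sn}\,s_3\neq0$, the point $r(s_1,s_2,s_3)$ converges to the point $(x,y,0)$ of the plane $z=0$ given by $$x=\mathrm{sn}\,s_1\,\mathrm{ns}\,s_3,\qquad y=\mathrm{cn}\,s_1\,\mathrm{ds}\,s_3,$$ and in this plane each limiting curve $s_1+\epsilon s_3=\lambda$ (with $\mathrm{sn}\,s_3\neq 0$) is a straight line tangent to the ellipse $x^2+\dfrac{y^2}{1-k^2}=1$. -/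

import Mathlib

open scoped ContDiff

/-- The incomplete elliptic integral of the first kind `F(φ, k)`. -/
noncomputable def ellipticF (k φ : ℝ) : ℝ :=
  ∫ θ in (0 : ℝ)..φ, 1 / Real.sqrt (1 - k ^ 2 * Real.sin θ ^ 2)

/-- The Jacobi amplitude `am(u, k)`: for `0 ≤ k < 1`, the inverse of the strictly increasing
bijection `φ ↦ F(φ, k)` of the real line. -/
noncomputable def jacobiAm (k : ℝ) : ℝ → ℝ := Function.invFun (ellipticF k)

/-- The Jacobi elliptic function `sn(u, k)`. -/
noncomputable def jacobiSn (k u : ℝ) : ℝ := Real.sin (jacobiAm k u)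

/-- The Jacobi elliptic function `cn(u, k)`. -/
noncomputable def jacobiCn (k u : ℝ) : ℝ := Real.cos (jacobiAm k u)

/-- The Jacobi elliptic function `dn(u, k)`. -/
noncomputable def jacobiDn (k u : ℝ) : ℝ := Real.sqrt (1 - k ^ 2 * jacobiSn k u ^ 2)

/-- The parametrisation `(x, y, z)` of the confocal coordinate system by
`(s₁, s₂, s₃) = (s 0, s 1, s 2)`:
`x = sn s₁ dc s₂ ns s₃`, `y = cn s₁ nc s₂ ds s₃`, `z = dn s₁ sc s₂ cs s₃`. -/
noncomputable def confocalMap (k : ℝ) (s : Fin 3 → ℝ) : EuclideanSpace ℝ (Fin 3) :=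
  !₂[jacobiSn k (s 0) * (jacobiDn k (s 1) / jacobiCn k (s 1)) * (1 / jacobiSn k (s 2)),
     jacobiCn k (s 0) * (1 / jacobiCn k (s 1)) * (jacobiDn k (s 2) / jacobiSn k (s 2)),
     jacobiDn k (s 0) * (jacobiSn k (s 1) / jacobiCn k (s 1)) *
       (jacobiCn k (s 2) / jacobiSn k (s 2))]

/-- The parameter values at which `confocalMap` has no vanishing denominator. -/
def confocalDomain (k : ℝ) : Set (Fin 3 → ℝ) :=
  {s | jacobiCn k (s 1) ≠ 0 ∧ jacobiSn k (s 2) ≠ 0}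

/-- The parameter values at which the quadrics `s₂ = const` and `s₃ = const` through the point,
with parameters `μ = -b + (b - c) nc² s₂` and `μ = -a + (a - c) ns² s₃` (where `a - c = 1` and
`a - b = k ^ 2`), are distinct, so that three different confocal quadrics meet. -/
def confocalRegular (k : ℝ) : Set (Fin 3 → ℝ) :=
  {s | s ∈ confocalDomain k ∧
    k ^ 2 + (1 - k ^ 2) / jacobiCn k (s 1) ^ 2 ≠ 1 / jacobiSn k (s 2) ^ 2}

/-- The four functions `λ₁, λ₂, λ₃, λ₄` of `(s₁, s₂, s₃)`. -/
def webParam : Fin 4 → (Fin 3 → ℝ) → ℝ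
  | 0, s => s 0 + s 1 + s 2
  | 1, s => s 0 + s 1 - s 2
  | 2, s => s 0 - s 1 + s 2
  | 3, s => s 0 - s 1 - s 2

/-- The four families of planes. -/
def webPlane (k : ℝ) : Fin 4 → ℝ → Set (EuclideanSpace ℝ (Fin 3))
  | 0, l => {p | p 0 * jacobiCn k l - p 1 * jacobiSn k l + p 2 + jacobiDn k l = 0}
  | 1, l => {p | p 0 * jacobiCn k l - p 1 * jacobiSn k l + p 2 - jacobiDn k l = 0}
  | 2, l => {p | -(p 0 * jacobiCn k l) + p 1 * jacobiSn k l + p 2 - jacobiDn k l = 0}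
  | 3, l => {p | -(p 0 * jacobiCn k l) + p 1 * jacobiSn k l + p 2 + jacobiDn k l = 0}

/-- The one-parameter family of sets `Σ c` is the smooth foliation of `Ω` by the level surfaces of
the function `f`, which has no critical point in `Ω`. -/
def IsLevelFoliation (Ω : Set (EuclideanSpace ℝ (Fin 3))) (f : EuclideanSpace ℝ (Fin 3) → ℝ)
    (S : ℝ → Set (EuclideanSpace ℝ (Fin 3))) : Prop :=
  ContDiffOn ℝ ∞ f Ω ∧ (∀ p ∈ Ω, fderiv ℝ f p ≠ 0) ∧ ∀ c, S c = {p | p ∈ Ω ∧ f p = c}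

/-- Four one-parameter families of surfaces form an octahedral web of surfaces in the open region
`Ω`: each family foliates `Ω`, any three of the families define a coordinate system, and there are
three further families of diagonal surfaces `T₁₂ = T₃₄`, `T₂₃ = T₁₄`, `T₁₃ = T₂₄` such that any two
surfaces of the `i`-th and `k`-th family meet in a surface of the family `Tᵢₖ`. -/
def IsOctahedralWeb (Ω : Set (EuclideanSpace ℝ (Fin 3)))
    (S : Fin 4 → ℝ → Set (EuclideanSpace ℝ (Fin 3))) : Prop :=
  IsOpen Ω ∧ Ω.Nonempty ∧
  (∃ f : Fin 4 → EuclideanSpace ℝ (Fin 3) → ℝ,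
    (∀ i, IsLevelFoliation Ω (f i) (S i)) ∧
    ∀ j : Fin 4,
      Set.InjOn (fun p => fun i : {i : Fin 4 // i ≠ j} => f i p) Ω ∧
      ∀ p ∈ Ω, LinearIndependent ℝ (fun i : {i : Fin 4 // i ≠ j} => fderiv ℝ (f i) p)) ∧
  ∃ T₁₂ T₂₃ T₁₃ : ℝ → Set (EuclideanSpace ℝ (Fin 3)),
    (∃ g, IsLevelFoliation Ω g T₁₂) ∧ (∃ g, IsLevelFoliation Ω g T₂₃) ∧
    (∃ g, IsLevelFoliation Ω g T₁₃) ∧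
    ∀ c d : ℝ,
      (∃ e, S 0 c ∩ S 1 d ⊆ T₁₂ e) ∧ (∃ e, S 2 c ∩ S 3 d ⊆ T₁₂ e) ∧
      (∃ e, S 1 c ∩ S 2 d ⊆ T₂₃ e) ∧ (∃ e, S 0 c ∩ S 3 d ⊆ T₂₃ e) ∧
      (∃ e, S 0 c ∩ S 2 d ⊆ T₁₃ e) ∧ (∃ e, S 1 c ∩ S 3 d ⊆ T₁₃ e)

/-- `P` is the tangent hyperplane (a plane in dimension three, a line in dimension two), at some
regular point, of the hypersurface `q = c`. -/
def IsTangentTo {n : ℕ} (P : Set (EuclideanSpace ℝ (Fin n))) (q : EuclideanSpace ℝ (Fin n) → ℝ)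
    (c : ℝ) : Prop :=
  ∃ p, q p = c ∧ fderiv ℝ q p ≠ 0 ∧ P = {x | fderiv ℝ q p (x - p) = 0}

/-- The confocal quadrics in Minkowski space are the sets `confocalForm a b c μ p = 1`. -/
noncomputable def confocalForm (a b c μ : ℝ) (p : EuclideanSpace ℝ (Fin 3)) : ℝ :=
  p 0 ^ 2 / (μ + a) + p 1 ^ 2 / (μ + b) - p 2 ^ 2 / (μ + c)

/-- `P` and `Q` are planes which have a common point and enclose the (non-obtuse, Euclidean)
angle `θ`. -/
def MeetAtAngle (P Q : Set (EuclideanSpace ℝ (Fin 3))) (θ : ℝ) : Prop :=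
  ∃ p n m : EuclideanSpace ℝ (Fin 3), n ≠ 0 ∧ m ≠ 0 ∧
    P = {x | inner ℝ n (x - p) = 0} ∧ Q = {x | inner ℝ m (x - p) = 0} ∧
    θ = Real.arccos (|inner ℝ n m| / (‖n‖ * ‖m‖))

/-- For a unit vector `w` and `0 < α < π / 2`, the zero set of this function is the circular cone
with vertex `v`, axis direction `w` and half-opening angle `α`. -/
noncomputable def coneForm (v w : EuclideanSpace ℝ (Fin 3)) (α : ℝ)
    (p : EuclideanSpace ℝ (Fin 3)) : ℝ :=
  (inner ℝ w (p - v)) ^ 2 - Real.cos α ^ 2 * ‖p - v‖ ^ 2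

/-- `v` is the vertex of a circular cone touching the four planes `P i`. -/
def IsVertexOfTouchingCone (v : EuclideanSpace ℝ (Fin 3))
    (P : Fin 4 → Set (EuclideanSpace ℝ (Fin 3))) : Prop :=
  ∃ (w : EuclideanSpace ℝ (Fin 3)) (α : ℝ), ‖w‖ = 1 ∧ 0 < α ∧ α < Real.pi / 2 ∧
    ∀ i, IsTangentTo (P i) (coneForm v w α) 0

/-- The curve `s₁ + ε s₃ = l` on the coordinate surface with the given value of `s₂`. -/
def asymptoticCurve (k s₂ ε l : ℝ) : Set (EuclideanSpace ℝ (Fin 3)) :=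
  {p | ∃ s₁ s₃ : ℝ, jacobiSn k s₃ ≠ 0 ∧ s₁ + ε * s₃ = l ∧ p = confocalMap k ![s₁, s₂, s₃]}

/-- `(x, y) = (sn s₁ ns s₃, cn s₁ ds s₃)`. -/
noncomputable def planarMap (k s₁ s₃ : ℝ) : EuclideanSpace ℝ (Fin 2) :=
  !₂[jacobiSn k s₁ * (1 / jacobiSn k s₃), jacobiCn k s₁ * (jacobiDn k s₃ / jacobiSn k s₃)]

/-!
The Jacobi functions are obtained from the amplitude, the inverse of the elliptic integral, whose
derivative is `dn`; each addition theorem holds because the quotient on its right hand side, as a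
function of `u` with `u + v` fixed, has derivative zero.

The incidence of the point `r(s)` with the four planes is the identity `jacobi_four_term`, a
consequence of the addition theorems, up to the signs of `s₂` and `s₃`. By its derivatives `r` is
an orthogonal coordinate system for the Minkowski metric, and the squared lengths of the coordinate
vector fields are products of differences of the parameters of the three quadrics through the
point (`injective_fderiv_confocalMap`). Hence `r` is a local diffeomorphism on `confocalRegular`.

On an open set on which `r` is injective, the four functions `λₘ` become smooth functions of the
point of which any three have independent differentials, the only relation between them being
`λ₁ + λ₄ = λ₂ + λ₃`; sums and differences of two of them are multiples of the coordinates, so that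
the coordinate surfaces are the diagonal surfaces of the web. That the surface `λₘ = l` is
relatively open in its plane is the local statement `exists_isOpen_inter_hyperplane_subset_image`.

The remaining assertions concern the planes alone. The normal of every plane can be scaled to
`(± cn, ∓ sn, 1)`, with horizontal part on the unit circle. So all planes are inclined at 45
degrees, and four of them with a common point touch the cone with vertical axis there; the common point is
unique unless the four points on the circle lie on a line, which they can do only if they coincide
in pairs (`eq_of_mem_webPlane`). The curve `s₁ + ε s₃ = l` on a surface `s₂ = const` lies in two of
the planes; it is their whole intersection, because the height takes every real value on it, by the
intermediate value theorem over a half period (`exists_eq_mul_jacobiSn`).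
-/

/-! ### The Jacobi elliptic functions -/

section Jacobi

variable {k : ℝ}

lemma ellipticF_denom_pos (hk : k ^ 2 < 1) (θ : ℝ) : 0 < 1 - k ^ 2 * Real.sin θ ^ 2 := by
  nlinarith [Real.sin_sq_le_one θ, sq_nonneg k, sq_nonneg (Real.sin θ)]

lemma continuous_ellipticF_integrand (hk : k ^ 2 < 1) :
    Continuous fun θ : ℝ => 1 / Real.sqrt (1 - k ^ 2 * Real.sin θ ^ 2) :=
  continuous_const.div (by fun_prop) fun θ => (Real.sqrt_pos.2 (ellipticF_denom_pos hk θ)).ne'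

lemma hasDerivAt_ellipticF (hk : k ^ 2 < 1) (φ : ℝ) :
    HasDerivAt (ellipticF k) (1 / Real.sqrt (1 - k ^ 2 * Real.sin φ ^ 2)) φ :=
  (continuous_ellipticF_integrand hk).integral_hasStrictDerivAt 0 φ |>.hasDerivAt

lemma ellipticF_zero : ellipticF k 0 = 0 := by simp [ellipticF]

lemma strictMono_ellipticF (hk : k ^ 2 < 1) : StrictMono (ellipticF k) :=
  strictMono_of_deriv_pos fun φ => by
    rw [(hasDerivAt_ellipticF hk φ).deriv]
    exact one_div_pos.2 (Real.sqrt_pos.2 (ellipticF_denom_pos hk φ))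

/-- The derivative of `F(·, k)` is at least `1`, so `F(·, k)` is unbounded in both directions. -/
lemma monotone_ellipticF_sub_id (hk : k ^ 2 < 1) : Monotone fun φ => ellipticF k φ - φ := by
  have h (φ : ℝ) : HasDerivAt (fun φ => ellipticF k φ - φ)
      (1 / Real.sqrt (1 - k ^ 2 * Real.sin φ ^ 2) - 1) φ :=
    (hasDerivAt_ellipticF hk φ).sub (hasDerivAt_id φ)
  refine monotone_of_deriv_nonneg (fun φ => (h φ).differentiableAt) fun φ => ?_
  rw [(h φ).deriv, sub_nonneg, le_div_iff₀ (Real.sqrt_pos.2 (ellipticF_denom_pos hk φ)), one_mul,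
    Real.sqrt_le_iff]
  refine ⟨zero_le_one, ?_⟩
  nlinarith [mul_nonneg (sq_nonneg k) (sq_nonneg (Real.sin φ))]

lemma surjective_ellipticF (hk : k ^ 2 < 1) : Function.Surjective (ellipticF k) := by
  have hc : Continuous (ellipticF k) :=
    continuous_iff_continuousAt.2 fun φ => (hasDerivAt_ellipticF hk φ).continuousAt
  have h0 : ellipticF k 0 - 0 = 0 := by simp [ellipticF_zero]
  refine hc.surjective ?_ ?_
  · refine Filter.tendsto_atTop_mono' _ ?_ Filter.tendsto_id
    filter_upwards [Filter.eventually_ge_atTop 0] with φ hφ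
    have := monotone_ellipticF_sub_id hk hφ
    simp only [id] at this ⊢
    linarith
  · refine Filter.tendsto_atBot_mono' _ ?_ Filter.tendsto_id
    filter_upwards [Filter.eventually_le_atBot 0] with φ hφ
    have := monotone_ellipticF_sub_id hk hφ
    simp only [id] at this ⊢
    linarith

lemma ellipticF_jacobiAm (hk : k ^ 2 < 1) (u : ℝ) : ellipticF k (jacobiAm k u) = u :=
  Function.rightInverse_invFun (surjective_ellipticF hk) u

lemma jacobiAm_ellipticF (hk : k ^ 2 < 1) (φ : ℝ) : jacobiAm k (ellipticF k φ) = φ :=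
  Function.leftInverse_invFun (strictMono_ellipticF hk).injective φ

lemma continuous_jacobiAm (hk : k ^ 2 < 1) : Continuous (jacobiAm k) := by
  have hmono : StrictMono (jacobiAm k) := fun u v huv => by
    rw [← (strictMono_ellipticF hk).lt_iff_lt, ellipticF_jacobiAm hk, ellipticF_jacobiAm hk]
    exact huv
  exact hmono.monotone.continuous_of_surjective fun φ => ⟨_, jacobiAm_ellipticF hk φ⟩

lemma hasDerivAt_jacobiAm (hk : k ^ 2 < 1) (u : ℝ) :
    HasDerivAt (jacobiAm k) (jacobiDn k u) u := by
  have h := HasDerivAt.of_local_left_inverse (continuous_jacobiAm hk).continuousAt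
    (hasDerivAt_ellipticF hk (jacobiAm k u))
    (one_div_pos.2 (Real.sqrt_pos.2 (ellipticF_denom_pos hk _))).ne'
    (Filter.Eventually.of_forall (ellipticF_jacobiAm hk))
  simpa [jacobiDn, jacobiSn] using h

lemma jacobiSn_sq_add_jacobiCn_sq (u : ℝ) : jacobiSn k u ^ 2 + jacobiCn k u ^ 2 = 1 :=
  Real.sin_sq_add_cos_sq _

lemma jacobiDn_sq (hk : k ^ 2 < 1) (u : ℝ) : jacobiDn k u ^ 2 = 1 - k ^ 2 * jacobiSn k u ^ 2 :=
  Real.sq_sqrt (ellipticF_denom_pos hk _).le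

lemma jacobiDn_pos (hk : k ^ 2 < 1) (u : ℝ) : 0 < jacobiDn k u :=
  Real.sqrt_pos.2 (ellipticF_denom_pos hk _)

lemma hasDerivAt_jacobiSn (hk : k ^ 2 < 1) (u : ℝ) :
    HasDerivAt (jacobiSn k) (jacobiCn k u * jacobiDn k u) u :=
  (hasDerivAt_jacobiAm hk u).sin

lemma hasDerivAt_jacobiCn (hk : k ^ 2 < 1) (u : ℝ) :
    HasDerivAt (jacobiCn k) (-jacobiSn k u * jacobiDn k u) u :=
  (hasDerivAt_jacobiAm hk u).cos

lemma hasDerivAt_jacobiDn (hk : k ^ 2 < 1) (u : ℝ) :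
    HasDerivAt (jacobiDn k) (-k ^ 2 * jacobiSn k u * jacobiCn k u) u := by
  have hd := (jacobiDn_pos hk u).ne'
  have h := ((((hasDerivAt_jacobiSn hk u).pow 2).const_mul (k ^ 2)).const_sub 1).sqrt
    (ellipticF_denom_pos hk (jacobiAm k u)).ne'
  refine h.congr_deriv ?_
  change -(k ^ 2 * _) / (2 * jacobiDn k u) = _
  field_simp
  simp
  ring

lemma contDiff_jacobiAm (hk : k ^ 2 < 1) : ContDiff ℝ ∞ (jacobiAm k) := by
  refine contDiff_infty.2 fun n => ?_
  induction n with
  | zero => exact contDiff_zero.2 (continuous_jacobiAm hk)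
  | succ n ih =>
    suffices h : ContDiff ℝ n (deriv (jacobiAm k)) by
      exact_mod_cast contDiff_succ_iff_deriv.2
        ⟨fun u => (hasDerivAt_jacobiAm hk u).differentiableAt, by simp, h⟩
    rw [funext fun u => (hasDerivAt_jacobiAm hk u).deriv]
    exact ContDiff.sqrt (contDiff_const.sub (contDiff_const.mul (ih.sin.pow 2)))
      fun u => (ellipticF_denom_pos hk _).ne'

lemma contDiff_jacobiSn (hk : k ^ 2 < 1) : ContDiff ℝ ∞ (jacobiSn k) :=
  (contDiff_jacobiAm hk).sin

lemma contDiff_jacobiCn (hk : k ^ 2 < 1) : ContDiff ℝ ∞ (jacobiCn k) :=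
  (contDiff_jacobiAm hk).cos

lemma contDiff_jacobiDn (hk : k ^ 2 < 1) : ContDiff ℝ ∞ (jacobiDn k) :=
  ContDiff.sqrt (contDiff_const.sub (contDiff_const.mul ((contDiff_jacobiSn hk).pow 2)))
    fun _ => (ellipticF_denom_pos hk _).ne'

lemma jacobiAm_zero (hk : k ^ 2 < 1) : jacobiAm k 0 = 0 := by
  simpa [ellipticF_zero] using jacobiAm_ellipticF hk 0

lemma jacobiSn_zero (hk : k ^ 2 < 1) : jacobiSn k 0 = 0 := by simp [jacobiSn, jacobiAm_zero hk]

lemma jacobiCn_zero (hk : k ^ 2 < 1) : jacobiCn k 0 = 1 := by simp [jacobiCn, jacobiAm_zero hk]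

lemma jacobiDn_zero (hk : k ^ 2 < 1) : jacobiDn k 0 = 1 := by simp [jacobiDn, jacobiSn_zero hk]

lemma ellipticF_neg (φ : ℝ) : ellipticF k (-φ) = -ellipticF k φ := by
  have h := intervalIntegral.integral_comp_neg (a := 0) (b := φ)
    fun θ : ℝ => 1 / Real.sqrt (1 - k ^ 2 * Real.sin θ ^ 2)
  simp only [Real.sin_neg, neg_sq, neg_zero] at h
  rw [ellipticF, intervalIntegral.integral_symm, ← h, ellipticF]

lemma jacobiAm_neg (hk : k ^ 2 < 1) (u : ℝ) : jacobiAm k (-u) = -jacobiAm k u :=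
  (strictMono_ellipticF hk).injective (by simp [ellipticF_neg, ellipticF_jacobiAm hk])

lemma jacobiSn_neg (hk : k ^ 2 < 1) (u : ℝ) : jacobiSn k (-u) = -jacobiSn k u := by
  simp [jacobiSn, jacobiAm_neg hk]

lemma jacobiCn_neg (hk : k ^ 2 < 1) (u : ℝ) : jacobiCn k (-u) = jacobiCn k u := by
  simp [jacobiCn, jacobiAm_neg hk]

lemma jacobiDn_neg (hk : k ^ 2 < 1) (u : ℝ) : jacobiDn k (-u) = jacobiDn k u := by
  simp [jacobiDn, jacobiSn_neg hk]

lemma jacobi_add_denom_pos (hk : k ^ 2 < 1) (u v : ℝ) :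
    0 < 1 - k ^ 2 * jacobiSn k u ^ 2 * jacobiSn k v ^ 2 := by
  have hu : jacobiSn k u ^ 2 ≤ 1 := Real.sin_sq_le_one _
  have hv : jacobiSn k v ^ 2 ≤ 1 := Real.sin_sq_le_one _
  have := mul_le_one₀ hu (sq_nonneg _) hv
  nlinarith [sq_nonneg k, mul_nonneg (sq_nonneg (jacobiSn k u)) (sq_nonneg (jacobiSn k v))]

/-- A quotient `N / D` is constant if `N' D = N D'`. For functions of `(t, c - t)` this gives the
addition theorems, by comparison of `t = 0` with `t = u`, where `c = u + v`. -/
lemma div_eq_of_hasDerivAt {N N' D D' : ℝ → ℝ} (hN : ∀ t, HasDerivAt N (N' t) t)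
    (hD : ∀ t, HasDerivAt D (D' t) t) (h0 : ∀ t, D t ≠ 0) (h : ∀ t, N' t * D t = N t * D' t)
    (x y : ℝ) : N x / D x = N y / D y := by
  have hq (t : ℝ) : HasDerivAt (fun t => N t / D t) 0 t := by
    refine ((hN t).div (hD t) (h0 t)).congr_deriv ?_
    rw [h t, sub_self, zero_div]
  exact is_const_of_deriv_eq_zero (fun t => (hq t).differentiableAt) (fun t => (hq t).deriv) x y

lemma hasDerivAt_jacobiSn_const_sub (hk : k ^ 2 < 1) (c u : ℝ) :
    HasDerivAt (fun t => jacobiSn k (c - t)) (-(jacobiCn k (c - u) * jacobiDn k (c - u))) u := by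
  simpa using (hasDerivAt_jacobiSn hk (c - u)).comp_const_sub c u

lemma hasDerivAt_jacobiCn_const_sub (hk : k ^ 2 < 1) (c u : ℝ) :
    HasDerivAt (fun t => jacobiCn k (c - t)) (jacobiSn k (c - u) * jacobiDn k (c - u)) u := by
  simpa using (hasDerivAt_jacobiCn hk (c - u)).comp_const_sub c u

lemma hasDerivAt_jacobiDn_const_sub (hk : k ^ 2 < 1) (c u : ℝ) :
    HasDerivAt (fun t => jacobiDn k (c - t))
      (k ^ 2 * jacobiSn k (c - u) * jacobiCn k (c - u)) u := by
  simpa using (hasDerivAt_jacobiDn hk (c - u)).comp_const_sub c u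

lemma hasDerivAt_jacobi_add_denom (hk : k ^ 2 < 1) (c u : ℝ) :
    HasDerivAt (fun t => 1 - k ^ 2 * jacobiSn k t ^ 2 * jacobiSn k (c - t) ^ 2)
      (2 * k ^ 2 * jacobiSn k u * jacobiSn k (c - u) *
        (jacobiSn k u * jacobiCn k (c - u) * jacobiDn k (c - u) -
          jacobiSn k (c - u) * jacobiCn k u * jacobiDn k u)) u := by
  refine (((((hasDerivAt_jacobiSn hk u).pow 2).const_mul (k ^ 2)).mul
    ((hasDerivAt_jacobiSn_const_sub hk c u).pow 2)).const_sub 1).congr_deriv ?_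
  simp
  ring

lemma jacobiSn_add (hk : k ^ 2 < 1) (u v : ℝ) : jacobiSn k (u + v) =
    (jacobiSn k u * jacobiCn k v * jacobiDn k v + jacobiSn k v * jacobiCn k u * jacobiDn k u) /
      (1 - k ^ 2 * jacobiSn k u ^ 2 * jacobiSn k v ^ 2) := by
  have h := div_eq_of_hasDerivAt (fun t =>
    (((hasDerivAt_jacobiSn hk t).mul (hasDerivAt_jacobiCn_const_sub hk (u + v) t)).mul
      (hasDerivAt_jacobiDn_const_sub hk (u + v) t)).add
    (((hasDerivAt_jacobiSn_const_sub hk (u + v) t).mul (hasDerivAt_jacobiCn hk t)).mul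
      (hasDerivAt_jacobiDn hk t)))
    (fun t => hasDerivAt_jacobi_add_denom hk (u + v) t)
    (fun t => (jacobi_add_denom_pos hk t (u + v - t)).ne') (fun t => ?_) 0 u
  · simpa [jacobiSn_zero hk, jacobiCn_zero hk, jacobiDn_zero hk] using h
  · have h1 := jacobiSn_sq_add_jacobiCn_sq (k := k) t
    have h2 := jacobiSn_sq_add_jacobiCn_sq (k := k) (u + v - t)
    have h3 := jacobiDn_sq hk t
    have h4 := jacobiDn_sq hk (u + v - t)
    simp only [Pi.add_apply, Pi.mul_apply]
    grind

lemma jacobiCn_add (hk : k ^ 2 < 1) (u v : ℝ) : jacobiCn k (u + v) =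
    (jacobiCn k u * jacobiCn k v -
        jacobiSn k u * jacobiDn k u * (jacobiSn k v * jacobiDn k v)) /
      (1 - k ^ 2 * jacobiSn k u ^ 2 * jacobiSn k v ^ 2) := by
  have h := div_eq_of_hasDerivAt (fun t =>
    ((hasDerivAt_jacobiCn hk t).mul (hasDerivAt_jacobiCn_const_sub hk (u + v) t)).sub
    (((hasDerivAt_jacobiSn hk t).mul (hasDerivAt_jacobiDn hk t)).mul
      ((hasDerivAt_jacobiSn_const_sub hk (u + v) t).mul
      (hasDerivAt_jacobiDn_const_sub hk (u + v) t))))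
    (fun t => hasDerivAt_jacobi_add_denom hk (u + v) t)
    (fun t => (jacobi_add_denom_pos hk t (u + v - t)).ne') (fun t => ?_) 0 u
  · simpa [jacobiSn_zero hk, jacobiCn_zero hk, jacobiDn_zero hk] using h
  · have h1 := jacobiSn_sq_add_jacobiCn_sq (k := k) t
    have h2 := jacobiSn_sq_add_jacobiCn_sq (k := k) (u + v - t)
    have h3 := jacobiDn_sq hk t
    have h4 := jacobiDn_sq hk (u + v - t)
    simp only [Pi.sub_apply, Pi.mul_apply]
    grind

lemma jacobiDn_add (hk : k ^ 2 < 1) (u v : ℝ) : jacobiDn k (u + v) =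
    (jacobiDn k u * jacobiDn k v -
        k ^ 2 * (jacobiSn k u * jacobiCn k u * (jacobiSn k v * jacobiCn k v))) /
      (1 - k ^ 2 * jacobiSn k u ^ 2 * jacobiSn k v ^ 2) := by
  have h := div_eq_of_hasDerivAt (fun t =>
    ((hasDerivAt_jacobiDn hk t).mul (hasDerivAt_jacobiDn_const_sub hk (u + v) t)).sub
    ((((hasDerivAt_jacobiSn hk t).mul (hasDerivAt_jacobiCn hk t)).mul
      ((hasDerivAt_jacobiSn_const_sub hk (u + v) t).mul
      (hasDerivAt_jacobiCn_const_sub hk (u + v) t))).const_mul (k ^ 2)))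
    (fun t => hasDerivAt_jacobi_add_denom hk (u + v) t)
    (fun t => (jacobi_add_denom_pos hk t (u + v - t)).ne') (fun t => ?_) 0 u
  · simpa [jacobiSn_zero hk, jacobiCn_zero hk, jacobiDn_zero hk] using h
  · have h1 := jacobiSn_sq_add_jacobiCn_sq (k := k) t
    have h2 := jacobiSn_sq_add_jacobiCn_sq (k := k) (u + v - t)
    have h3 := jacobiDn_sq hk t
    have h4 := jacobiDn_sq hk (u + v - t)
    simp only [Pi.sub_apply, Pi.mul_apply]
    grind

/-- A form of the addition theorem that is linear in the functions of `u + v`. -/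
lemma jacobiCn_mul_jacobiSn_add (hk : k ^ 2 < 1) (u v : ℝ) :
    jacobiCn k u * jacobiSn k (u + v) =
      jacobiSn k u * jacobiCn k (u + v) * jacobiDn k v + jacobiSn k v * jacobiDn k u := by
  have h0 := (jacobi_add_denom_pos hk u v).ne'
  rw [jacobiSn_add hk, jacobiCn_add hk]
  have h1 := jacobiSn_sq_add_jacobiCn_sq (k := k) u
  have h2 := jacobiSn_sq_add_jacobiCn_sq (k := k) v
  have h3 := jacobiDn_sq hk u
  have h4 := jacobiDn_sq hk v
  field_simp
  grind

/-- The addition theorem behind the incidence of the point with parameters `(u, v, w)` and the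
plane with parameter `u + v + w`. It follows from four instances of the linear form of the addition
theorem, on multiplying by `sn (v + w)`. -/
lemma jacobi_four_term (hk : k ^ 2 < 1) (u v w : ℝ) :
    jacobiSn k u * jacobiDn k v * jacobiCn k (u + v + w) -
      jacobiCn k u * jacobiDn k w * jacobiSn k (u + v + w) +
      jacobiDn k u * jacobiSn k v * jacobiCn k w +
      jacobiCn k v * jacobiSn k w * jacobiDn k (u + v + w) = 0 := by
  obtain ⟨p, rfl⟩ : ∃ p, v = p - w := ⟨v + w, by ring⟩
  rw [show u + (p - w) + w = u + p by ring]
  by_cases hp : jacobiSn k p = 0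
  · have hc : jacobiCn k p ^ 2 = 1 := by
      have := jacobiSn_sq_add_jacobiCn_sq (k := k) p
      rw [hp] at this
      linarith
    have hd : jacobiDn k p = 1 := by simp [jacobiDn, hp]
    rw [sub_eq_add_neg p w, jacobiSn_add hk, jacobiSn_add hk, jacobiCn_add hk, jacobiCn_add hk,
      jacobiDn_add hk, jacobiDn_add hk, jacobiSn_neg hk, jacobiCn_neg hk, jacobiDn_neg hk, hp, hd]
    simp
    grind
  · have h1 := jacobiCn_mul_jacobiSn_add hk u p
    have h2 := jacobiCn_mul_jacobiSn_add hk (u + p) (-p)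
    have h3 := jacobiCn_mul_jacobiSn_add hk (-w) p
    have h4 := jacobiCn_mul_jacobiSn_add hk (-(p - w)) p
    rw [show -(p - w) + p = w by ring] at h4
    rw [show -w + p = p - w by ring] at h3
    rw [show u + p + -p = u by ring] at h2
    simp only [jacobiSn_neg hk, jacobiCn_neg hk, jacobiDn_neg hk] at h2 h3 h4
    refine (mul_eq_zero.1 (?_ : jacobiSn k p * _ = 0)).resolve_left hp
    linear_combination (jacobiCn k u * jacobiSn k (u + p)) * h3 -
      (jacobiSn k u * jacobiCn k (u + p)) * h4 -
      jacobiSn k (p - w) * jacobiCn k w * h1 + jacobiSn k w * jacobiCn k (p - w) * h2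

/-- The points `(cn, sn)` of the unit circle with parameters `u + v` and `u - v` agree only if
`sn v = 0`. -/
lemma jacobiSn_eq_zero_of_eq (hk : k ^ 2 < 1) {u v : ℝ}
    (hs : jacobiSn k (u + v) = jacobiSn k (u - v)) (hc : jacobiCn k (u + v) = jacobiCn k (u - v)) :
    jacobiSn k v = 0 := by
  have h0 := (jacobi_add_denom_pos hk u v).ne'
  have hu := (jacobiDn_pos hk u).ne'
  have hv := (jacobiDn_pos hk v).ne'
  rw [sub_eq_add_neg, jacobiSn_add hk, jacobiSn_add hk, jacobiSn_neg hk, jacobiCn_neg hk,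
    jacobiDn_neg hk, neg_sq, div_left_inj' h0] at hs
  rw [sub_eq_add_neg, jacobiCn_add hk, jacobiCn_add hk, jacobiSn_neg hk, jacobiCn_neg hk,
    jacobiDn_neg hk, neg_sq, div_left_inj' h0] at hc
  have h1 := jacobiSn_sq_add_jacobiCn_sq (k := k) u
  by_contra hne
  have e1 : jacobiCn k u = 0 := by
    have : jacobiSn k v * jacobiDn k u * jacobiCn k u = 0 := by linear_combination hs / 2
    simpa [hne, hu] using this
  have e2 : jacobiSn k u = 0 := by
    have : jacobiSn k v * jacobiDn k u * jacobiDn k v * jacobiSn k u = 0 := by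
      linear_combination -hc / 2
    simpa [hne, hu, hv] using this
  simp [e1, e2] at h1

/-- The points `(cn, sn)` of the unit circle with parameters `u + v` and `u - v` are antipodal only
if `cn v = 0`. -/
lemma jacobiCn_eq_zero_of_eq_neg (hk : k ^ 2 < 1) {u v : ℝ}
    (hs : jacobiSn k (u + v) = -jacobiSn k (u - v))
    (hc : jacobiCn k (u + v) = -jacobiCn k (u - v)) :
    jacobiCn k v = 0 := by
  have h0 := (jacobi_add_denom_pos hk u v).ne'
  have hu := (jacobiDn_pos hk u).ne'
  have hv := (jacobiDn_pos hk v).ne'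
  rw [sub_eq_add_neg, jacobiSn_add hk, jacobiSn_add hk, jacobiSn_neg hk, jacobiCn_neg hk,
    jacobiDn_neg hk, neg_sq, ← neg_div, div_left_inj' h0] at hs
  rw [sub_eq_add_neg, jacobiCn_add hk, jacobiCn_add hk, jacobiSn_neg hk, jacobiCn_neg hk,
    jacobiDn_neg hk, neg_sq, ← neg_div, div_left_inj' h0] at hc
  have h1 := jacobiSn_sq_add_jacobiCn_sq (k := k) u
  by_contra hne
  have e1 : jacobiSn k u = 0 := by
    have : jacobiCn k v * jacobiDn k v * jacobiSn k u = 0 := by linear_combination hs / 2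
    simpa [hne, hv] using this
  have e2 : jacobiCn k u = 0 := by
    have : jacobiCn k v * jacobiCn k u = 0 := by
      linear_combination hc / 2
    simpa [hne] using this
  simp [e1, e2] at h1

/-- A shift by `2 v` with `sn v = 0`, that is, by a multiple of the common period of the three
functions. -/
lemma jacobi_add_eq_of_jacobiSn_eq_zero (hk : k ^ 2 < 1) {v : ℝ} (hv : jacobiSn k v = 0) (u : ℝ) :
    jacobiSn k (u + v) = jacobiSn k (u - v) ∧ jacobiCn k (u + v) = jacobiCn k (u - v) ∧
      jacobiDn k (u + v) = jacobiDn k (u - v) := by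
  simp [sub_eq_add_neg, jacobiSn_add hk, jacobiCn_add hk, jacobiDn_add hk, jacobiSn_neg hk,
    jacobiCn_neg hk, jacobiDn_neg hk, hv]

/-- A shift by `2 v` with `cn v = 0`, that is, by an odd multiple of half the period of `sn`. -/
lemma jacobi_add_eq_of_jacobiCn_eq_zero (hk : k ^ 2 < 1) {v : ℝ} (hv : jacobiCn k v = 0) (u : ℝ) :
    jacobiSn k (u + v) = -jacobiSn k (u - v) ∧ jacobiCn k (u + v) = -jacobiCn k (u - v) ∧
      jacobiDn k (u + v) = jacobiDn k (u - v) := by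
  simp [sub_eq_add_neg, jacobiSn_add hk, jacobiCn_add hk, jacobiDn_add hk, jacobiSn_neg hk,
    jacobiCn_neg hk, jacobiDn_neg hk, hv, neg_div]

/-- If `cn (v + w) = cn (v - w) = 0` and `sn w ≠ 0`, then `v` is a zero of `sn` and `w` one of
`cn`. -/
lemma jacobi_zeros_of_jacobiCn_add_sub_eq_zero (hk : k ^ 2 < 1) {v w : ℝ}
    (hv : jacobiCn k v ≠ 0) (hw : jacobiSn k w ≠ 0)
    (h1 : jacobiCn k (v + w) = 0) (h2 : jacobiCn k (v - w) = 0) :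
    jacobiSn k v = 0 ∧ jacobiCn k w = 0 := by
  have h0 := (jacobi_add_denom_pos hk v w).ne'
  have dv := (jacobiDn_pos hk v).ne'
  have dw := (jacobiDn_pos hk w).ne'
  rw [jacobiCn_add hk, div_eq_zero_iff, or_iff_left h0] at h1
  rw [sub_eq_add_neg, jacobiCn_add hk, jacobiSn_neg hk, jacobiCn_neg hk,
    jacobiDn_neg hk, neg_sq, div_eq_zero_iff, or_iff_left h0] at h2
  constructor
  · have : jacobiSn k v * jacobiDn k v * (jacobiSn k w * jacobiDn k w) = 0 := by
      linear_combination (h2 - h1) / 2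
    simpa [hw, dv, dw] using this
  · have : jacobiCn k v * jacobiCn k w = 0 := by linear_combination (h2 + h1) / 2
    simpa [hv] using this

/-- The half period `2K = F(π, k)`. -/
lemma jacobi_half_period (hk : k ^ 2 < 1) : jacobiSn k (ellipticF k Real.pi) = 0 ∧
    jacobiCn k (ellipticF k Real.pi) = -1 ∧ jacobiDn k (ellipticF k Real.pi) = 1 := by
  simp [jacobiDn, jacobiSn, jacobiCn, jacobiAm_ellipticF hk]

lemma jacobi_add_half_period (hk : k ^ 2 < 1) (u : ℝ) :
    jacobiSn k (u + ellipticF k Real.pi) = -jacobiSn k u ∧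
      jacobiCn k (u + ellipticF k Real.pi) = -jacobiCn k u ∧
      jacobiDn k (u + ellipticF k Real.pi) = jacobiDn k u := by
  simp [jacobiSn_add hk, jacobiCn_add hk, jacobiDn_add hk, jacobi_half_period hk]

lemma jacobi_sub_half_period (hk : k ^ 2 < 1) (u : ℝ) :
    jacobiSn k (u - ellipticF k Real.pi) = -jacobiSn k u ∧
      jacobiCn k (u - ellipticF k Real.pi) = -jacobiCn k u ∧
      jacobiDn k (u - ellipticF k Real.pi) = jacobiDn k u := by
  obtain ⟨h1, h2, h3⟩ := jacobi_add_half_period hk (u - ellipticF k Real.pi)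
  rw [sub_add_cancel] at h1 h2 h3
  exact ⟨by linarith, by linarith, h3.symm⟩

/-- If `f` is continuous, changes its sign over the half period of `sn` and does not vanish at the
zeros of `sn`, then the quotient `f / sn` takes every real value. -/
lemma exists_eq_mul_jacobiSn (hk : k ^ 2 < 1) {f : ℝ → ℝ} (hf : Continuous f)
    (h0 : f (ellipticF k Real.pi) = -f 0)
    (hne : ∀ s, jacobiSn k s = 0 → f s ≠ 0) (τ : ℝ) :
    ∃ s, jacobiSn k s ≠ 0 ∧ f s = τ * jacobiSn k s := by
  have hc : Continuous fun s => f s - τ * jacobiSn k s :=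
    hf.sub (continuous_const.mul (contDiff_jacobiSn hk).continuous)
  have hmem : (0 : ℝ) ∈ Set.uIcc (f 0 - τ * jacobiSn k 0)
      (f (ellipticF k Real.pi) - τ * jacobiSn k (ellipticF k Real.pi)) := by
    rw [h0, jacobiSn_zero hk, (jacobi_half_period hk).1, Set.mem_uIcc]
    simp only [mul_zero, sub_zero]
    rcases le_total 0 (f 0) with h | h
    · exact Or.inr ⟨by linarith, h⟩
    · exact Or.inl ⟨h, by linarith⟩
  obtain ⟨s, -, hs⟩ := intermediate_value_uIcc hc.continuousOn hmem
  replace hs : f s = τ * jacobiSn k s := sub_eq_zero.1 hs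
  exact ⟨s, fun h => hne s h (by rw [hs, h, mul_zero]), hs⟩

end Jacobi

/-! ### The confocal coordinate map -/

section ConfocalMap

variable {k : ℝ}

lemma hasDerivAt_jacobiDc (hk : k ^ 2 < 1) {u : ℝ} (hu : jacobiCn k u ≠ 0) :
    HasDerivAt (fun u => jacobiDn k u / jacobiCn k u)
      ((1 - k ^ 2) * (jacobiSn k u / jacobiCn k u) * (1 / jacobiCn k u)) u := by
  refine ((hasDerivAt_jacobiDn hk u).div (hasDerivAt_jacobiCn hk u) hu).congr_deriv ?_
  have h1 := jacobiSn_sq_add_jacobiCn_sq (k := k) u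
  have h2 := jacobiDn_sq hk u
  field_simp
  grind

lemma hasDerivAt_jacobiNc (hk : k ^ 2 < 1) {u : ℝ} (hu : jacobiCn k u ≠ 0) :
    HasDerivAt (fun u => 1 / jacobiCn k u)
      (jacobiSn k u / jacobiCn k u * (jacobiDn k u / jacobiCn k u)) u := by
  refine ((hasDerivAt_const u 1).div (hasDerivAt_jacobiCn hk u) hu).congr_deriv ?_
  field_simp
  ring

lemma hasDerivAt_jacobiSc (hk : k ^ 2 < 1) {u : ℝ} (hu : jacobiCn k u ≠ 0) :
    HasDerivAt (fun u => jacobiSn k u / jacobiCn k u)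
      (jacobiDn k u / jacobiCn k u * (1 / jacobiCn k u)) u := by
  refine ((hasDerivAt_jacobiSn hk u).div (hasDerivAt_jacobiCn hk u) hu).congr_deriv ?_
  have h1 := jacobiSn_sq_add_jacobiCn_sq (k := k) u
  field_simp
  grind

lemma hasDerivAt_jacobiNs (hk : k ^ 2 < 1) {u : ℝ} (hu : jacobiSn k u ≠ 0) :
    HasDerivAt (fun u => 1 / jacobiSn k u)
      (-(jacobiDn k u / jacobiSn k u * (jacobiCn k u / jacobiSn k u))) u := by
  refine ((hasDerivAt_const u 1).div (hasDerivAt_jacobiSn hk u) hu).congr_deriv ?_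
  field_simp
  ring

lemma hasDerivAt_jacobiDs (hk : k ^ 2 < 1) {u : ℝ} (hu : jacobiSn k u ≠ 0) :
    HasDerivAt (fun u => jacobiDn k u / jacobiSn k u)
      (-(jacobiCn k u / jacobiSn k u * (1 / jacobiSn k u))) u := by
  refine ((hasDerivAt_jacobiDn hk u).div (hasDerivAt_jacobiSn hk u) hu).congr_deriv ?_
  have h1 := jacobiDn_sq hk u
  field_simp
  grind

lemma hasDerivAt_jacobiCs (hk : k ^ 2 < 1) {u : ℝ} (hu : jacobiSn k u ≠ 0) :
    HasDerivAt (fun u => jacobiCn k u / jacobiSn k u)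
      (-(jacobiDn k u / jacobiSn k u * (1 / jacobiSn k u))) u := by
  refine ((hasDerivAt_jacobiCn hk u).div (hasDerivAt_jacobiSn hk u) hu).congr_deriv ?_
  have h1 := jacobiSn_sq_add_jacobiCn_sq (k := k) u
  field_simp
  grind

lemma contDiffAt_confocalMap (hk : k ^ 2 < 1) {s : Fin 3 → ℝ} (hs : s ∈ confocalDomain k) :
    ContDiffAt ℝ ∞ (confocalMap k) s := by
  obtain ⟨h2, h3⟩ := hs
  have hS := contDiff_jacobiSn hk
  have hC := contDiff_jacobiCn hk
  have hD := contDiff_jacobiDn hk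
  rw [contDiffAt_euclidean]
  intro i
  fin_cases i
  all_goals
    simp only [confocalMap]
    simp
    fun_prop (disch := assumption)

/-- The derivative of a function of one coordinate along a line. -/
lemma HasDerivAt.comp_line {f : ℝ → ℝ} {f' : ℝ} {s : Fin 3 → ℝ} {i : Fin 3}
    (hf : HasDerivAt f f' (s i)) (v : Fin 3 → ℝ) :
    HasDerivAt (fun t : ℝ => f (s i + t * v i)) (f' * v i) 0 := by
  have h : HasDerivAt (fun t : ℝ => s i + t * v i) (v i) 0 := by
    simpa using ((hasDerivAt_id (0 : ℝ)).mul_const (v i)).const_add (s i)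
  exact HasDerivAt.comp (h₂ := f) 0 (by simpa using hf) h

/-- The confocal coordinates are orthogonal for the Minkowski metric, and the squared lengths of
the coordinate vector fields are products of two differences of the parameters of the three
quadrics through the point. So the differential is injective where these are distinct. -/
lemma injective_fderiv_confocalMap (hk : k ^ 2 < 1) {s : Fin 3 → ℝ} (hs : s ∈ confocalRegular k) :
    Function.Injective (fderiv ℝ (confocalMap k) s) := by
  obtain ⟨⟨h2, h3⟩, hreg⟩ := hs
  rw [injective_iff_map_eq_zero]
  intro v hv
  have hline : HasDerivAt (fun t : ℝ => confocalMap k (s + t • v)) 0 0 := by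
    have hl : HasDerivAt (fun t : ℝ => s + t • v) v 0 := by
      simpa using ((hasDerivAt_id (0 : ℝ)).smul_const v).const_add s
    have hd := ((contDiffAt_confocalMap hk ⟨h2, h3⟩).differentiableAt (by simp)).hasFDerivAt
    rw [← hv]
    exact HasFDerivAt.comp_hasDerivAt (l := confocalMap k) 0 (by simpa using hd) hl
  have hcoord (i : Fin 3) : HasDerivAt (fun t : ℝ => confocalMap k (s + t • v) i) 0 0 :=
    ((EuclideanSpace.proj i : EuclideanSpace ℝ (Fin 3) →L[ℝ] ℝ).hasFDerivAt.comp_hasDerivAt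
      0 hline).congr_deriv (by simp)
  have hx := (hcoord 0).unique
    ((((hasDerivAt_jacobiSn hk (s 0)).comp_line v).mul
      ((hasDerivAt_jacobiDc hk h2).comp_line v)).mul
      ((hasDerivAt_jacobiNs hk h3).comp_line v))
  have hy := (hcoord 1).unique
    ((((hasDerivAt_jacobiCn hk (s 0)).comp_line v).mul
      ((hasDerivAt_jacobiNc hk h2).comp_line v)).mul
      ((hasDerivAt_jacobiDs hk h3).comp_line v))
  have hz := (hcoord 2).unique
    ((((hasDerivAt_jacobiDn hk (s 0)).comp_line v).mul
      ((hasDerivAt_jacobiSc hk h2).comp_line v)).mul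
      ((hasDerivAt_jacobiCs hk h3).comp_line v))
  simp only [Pi.mul_apply, zero_mul, zero_smul, add_zero] at hx hy hz
  have eA : (jacobiDn k (s 1) / jacobiCn k (s 1)) ^ 2 =
      k ^ 2 + (1 - k ^ 2) * (1 / jacobiCn k (s 1)) ^ 2 := by
    have := jacobiSn_sq_add_jacobiCn_sq (k := k) (s 1)
    have := jacobiDn_sq hk (s 1)
    field_simp
    grind
  have eC : (jacobiSn k (s 1) / jacobiCn k (s 1)) ^ 2 = (1 / jacobiCn k (s 1)) ^ 2 - 1 := by
    have := jacobiSn_sq_add_jacobiCn_sq (k := k) (s 1)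
    field_simp
    grind
  have em : (jacobiDn k (s 2) / jacobiSn k (s 2)) ^ 2 = (1 / jacobiSn k (s 2)) ^ 2 - k ^ 2 := by
    have := jacobiDn_sq hk (s 2)
    field_simp
    grind
  have eq : (jacobiCn k (s 2) / jacobiSn k (s 2)) ^ 2 = (1 / jacobiSn k (s 2)) ^ 2 - 1 := by
    have := jacobiSn_sq_add_jacobiCn_sq (k := k) (s 2)
    field_simp
    grind
  have ec := jacobiSn_sq_add_jacobiCn_sq (k := k) (s 0)
  have ed := jacobiDn_sq hk (s 0)
  have hAn : (jacobiDn k (s 1) / jacobiCn k (s 1)) ^ 2 ≠ (1 / jacobiSn k (s 2)) ^ 2 := by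
    rw [eA]
    simpa [div_eq_mul_inv] using hreg
  generalize jacobiDn k (s 1) / jacobiCn k (s 1) = A at *
  generalize 1 / jacobiCn k (s 1) = B at *
  generalize jacobiSn k (s 1) / jacobiCn k (s 1) = C at *
  generalize jacobiDn k (s 2) / jacobiSn k (s 2) = m at *
  generalize 1 / jacobiSn k (s 2) = n at *
  generalize jacobiCn k (s 2) / jacobiSn k (s 2) = q at *
  generalize jacobiSn k (s 0) = S at *
  generalize jacobiCn k (s 0) = c at *
  generalize jacobiDn k (s 0) = d at *
  have hS : k ^ 2 * S ^ 2 < 1 := by nlinarith [sq_nonneg k, sq_nonneg c]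
  have hA1 : A ^ 2 - k ^ 2 * S ^ 2 ≠ 0 := by
    nlinarith [mul_nonneg (sub_nonneg.2 hk.le) (sq_nonneg C)]
  have hn1 : n ^ 2 - k ^ 2 * S ^ 2 ≠ 0 := by nlinarith [sq_nonneg q]
  have hAn' := sub_ne_zero.2 hAn
  -- the Minkowski products of the three coordinate vector fields
  have g11 : (c * d * A * n) ^ 2 + (S * d * B * m) ^ 2 - (k ^ 2 * S * c * C * q) ^ 2 =
      (A ^ 2 - k ^ 2 * S ^ 2) * (n ^ 2 - k ^ 2 * S ^ 2) := by
    simp only [mul_pow]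
    rw [eA, eC, em, eq, ed, show c ^ 2 = 1 - S ^ 2 by linarith]
    ring
  have g22 : (S * (1 - k ^ 2) * C * B * n) ^ 2 + (c * C * A * m) ^ 2 - (d * A * B * q) ^ 2 =
      (A ^ 2 - k ^ 2 * S ^ 2) * (A ^ 2 - n ^ 2) := by
    simp only [mul_pow]
    rw [eA, eC, em, eq, ed, show c ^ 2 = 1 - S ^ 2 by linarith]
    ring
  have g33 : (S * A * m * q) ^ 2 + (c * B * q * n) ^ 2 - (d * C * m * n) ^ 2 =
      (n ^ 2 - k ^ 2 * S ^ 2) * (n ^ 2 - A ^ 2) := by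
    simp only [mul_pow]
    rw [eA, eC, em, eq, ed, show c ^ 2 = 1 - S ^ 2 by linarith]
    ring
  have g12 : (1 - k ^ 2) * n ^ 2 - m ^ 2 + k ^ 2 * q ^ 2 = 0 := by rw [em, eq]; ring
  have g13 : -A ^ 2 + B ^ 2 - k ^ 2 * C ^ 2 = 0 := by rw [eA, eC]; ring
  have g23 : -((1 - k ^ 2) * S ^ 2) - c ^ 2 + d ^ 2 = 0 := by linear_combination ed - ec
  have e1 : (A ^ 2 - k ^ 2 * S ^ 2) * (n ^ 2 - k ^ 2 * S ^ 2) * v 0 = 0 := by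
    linear_combination -v 0 * g11 - c * d * A * n * hx + S * d * B * m * hy -
      k ^ 2 * S * c * C * q * hz - S * c * d * A * B * C * v 1 * g12 -
      S * c * d * m * n * q * v 2 * g13
  have e2 : (A ^ 2 - k ^ 2 * S ^ 2) * (A ^ 2 - n ^ 2) * v 1 = 0 := by
    linear_combination -v 1 * g22 - S * (1 - k ^ 2) * C * B * n * hx - c * C * A * m * hy +
      d * A * B * q * hz - S * c * d * A * B * C * v 0 * g12 - A * B * C * m * n * q * v 2 * g23
  have e3 : (n ^ 2 - k ^ 2 * S ^ 2) * (A ^ 2 - n ^ 2) * v 2 = 0 := by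
    linear_combination v 2 * g33 - S * A * m * q * hx - c * B * q * n * hy +
      d * C * m * n * hz + S * c * d * m * n * q * v 0 * g13 + A * B * C * m * n * q * v 1 * g23
  ext i
  fin_cases i
  · simpa [hA1, hn1] using e1
  · simpa [hA1, hAn'] using e2
  · simpa [hn1, hAn'] using e3

end ConfocalMap

/-! ### Local inverses and coordinate surfaces -/

section LocalInverse

variable {E F : Type*} [NormedAddCommGroup E] [NormedSpace ℝ E] [FiniteDimensional ℝ E]
  [NormedAddCommGroup F] [InnerProductSpace ℝ F]

lemma exists_continuousLinearEquiv_of_injective [FiniteDimensional ℝ F]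
    (h : Module.finrank ℝ E = Module.finrank ℝ F)
    {f : E →L[ℝ] F} (hf : Function.Injective f) : ∃ e : E ≃L[ℝ] F, (e : E →L[ℝ] F) = f :=
  ⟨(LinearMap.linearEquivOfInjective f.toLinearMap hf h).toContinuousLinearEquiv, by ext; rfl⟩

lemma contDiffAt_of_leftInvOn {r : E → F} {g : F → E} {V : Set E} {s : E} {e : E ≃L[ℝ] F}
    (hV : IsOpen V) (hs : s ∈ V) (hr : ContDiffAt ℝ ∞ r s)
    (he : HasFDerivAt r (e : E →L[ℝ] F) s) (hg : ∀ t ∈ V, g (r t) = t) :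
    ContDiffAt ℝ ∞ g (r s) := by
  have := FiniteDimensional.complete ℝ E
  have hst : HasStrictFDerivAt r (e : E →L[ℝ] F) s := hr.hasStrictFDerivAt' he (by simp)
  refine (hr.to_localInverse he (by simp)).congr_of_eventuallyEq ?_
  filter_upwards [hst.eventually_right_inverse,
    hst.localInverse_tendsto (hV.mem_nhds hs)] with y hy hyV
  have := hg _ hyV
  rwa [hy] at this

/-- Let the local diffeomorphism `r` map the hyperplane `ℓ = l` into the hyperplane `⟪n, ·⟫ = h`.
Then it maps neighbourhoods in the one onto neighbourhoods in the other: the map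
`t ↦ r (t - (ℓ t - l) w) + (ℓ t - l) n`, where `ℓ w = 1`, agrees with `r` on the first hyperplane,
is again a local diffeomorphism, and sends no other points near `s` to the second hyperplane. -/
lemma exists_isOpen_inter_hyperplane_subset_image [FiniteDimensional ℝ F] {r : E → F} {s w : E}
    {e : E ≃L[ℝ] F} (he : HasStrictFDerivAt r (e : E →L[ℝ] F) s) {ℓ : E →L[ℝ] ℝ} (hw : ℓ w = 1)
    {n : F}
    (hn : n ≠ 0) {l h : ℝ} (hs : ℓ s = l)
    (hr : ∀ᶠ t in nhds s, ℓ t = l → inner ℝ n (r t) = h) {W : Set E} (hW : W ∈ nhds s) :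
    ∃ O : Set F, IsOpen O ∧ r s ∈ O ∧
      O ∩ {p | inner ℝ n p = h} ⊆ r '' {t | t ∈ W ∧ ℓ t = l} := by
  have := FiniteDimensional.complete ℝ E
  have hnn : inner ℝ n n ≠ 0 := inner_self_ne_zero.2 hn
  set π : E → E := fun t => t - (ℓ t - l) • w with hπ
  have hπs : π s = s := by simp [hπ, hs]
  have hπℓ (t : E) : ℓ (π t) = l := by simp [hπ, hw]
  have hπd : HasStrictFDerivAt π (ContinuousLinearMap.id ℝ E - ℓ.smulRight w) s :=
    (hasStrictFDerivAt_id s).sub ((ℓ.hasStrictFDerivAt.sub_const l).smul_const w)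
  set R : E → F := fun t => r (π t) + (ℓ t - l) • n with hR
  have hRs : R s = r s := by simp [hR, hπs, hs]
  set R' : E →L[ℝ] F := (e : E →L[ℝ] F).comp (ContinuousLinearMap.id ℝ E - ℓ.smulRight w) +
    ℓ.smulRight n with hR'
  have hRd : HasStrictFDerivAt R R' s :=
    (HasStrictFDerivAt.comp (g := r) s (by rwa [hπs]) hπd).add
      ((ℓ.hasStrictFDerivAt.sub_const l).smul_const n)
  have hπc : Filter.Tendsto π (nhds s) (nhds s) := by
    have := hπd.hasFDerivAt.continuousAt
    rwa [ContinuousAt, hπs] at this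
  have hval : ∀ᶠ t in nhds s, inner ℝ n (R t) = h + (ℓ t - l) * inner ℝ n n := by
    filter_upwards [hπc.eventually hr] with t ht
    rw [hR, inner_add_right, inner_smul_right, ht (hπℓ t)]
  have hval' (v : E) : inner ℝ n (R' v) = ℓ v * inner ℝ n n := by
    have h1 : HasFDerivAt (fun t => inner ℝ n (R t)) ((innerSL ℝ n).comp R') s :=
      (innerSL ℝ n).hasFDerivAt.comp s hRd.hasFDerivAt
    have h2 : HasFDerivAt (fun t => h + (ℓ t - l) * inner ℝ n n) (inner ℝ n n • ℓ) s :=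
      ((ℓ.hasFDerivAt.sub_const l).mul_const _).const_add h
    have := congrArg (fun L : E →L[ℝ] ℝ => L v) (h1.unique (h2.congr_of_eventuallyEq hval))
    simpa [mul_comm] using this
  have hinj : Function.Injective R' := by
    rw [injective_iff_map_eq_zero]
    intro v hv
    have hℓ : ℓ v = 0 := by
      have := hval' v
      rw [hv, inner_zero_right] at this
      exact (mul_eq_zero.1 this.symm).resolve_right hnn
    simpa [hR', hℓ] using hv
  obtain ⟨e', he'⟩ := exists_continuousLinearEquiv_of_injective
    (LinearEquiv.finrank_eq e.toLinearEquiv) hinj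
  rw [← he'] at hRd
  have hmap := hRd.map_nhds_eq_of_equiv
  rw [hRs] at hmap
  have himg : R '' {t | π t ∈ W ∧ inner ℝ n (R t) = h + (ℓ t - l) * inner ℝ n n} ∈ nhds (r s) := by
    rw [← hmap]
    exact Filter.image_mem_map (Filter.inter_mem (hπc hW) hval)
  refine ⟨interior (R '' _), isOpen_interior, mem_interior_iff_mem_nhds.2 himg, ?_⟩
  rintro p ⟨hp, hph⟩
  obtain ⟨t, ⟨htW, hth⟩, rfl⟩ := interior_subset hp
  have hl : ℓ t - l = 0 := by
    have : (ℓ t - l) * inner ℝ n n = 0 := by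
      have : inner ℝ n (R t) = h := hph
      linarith
    exact (mul_eq_zero.1 this).resolve_right hnn
  exact ⟨π t, ⟨htW, hπℓ t⟩, by simp [hR, hl]⟩

end LocalInverse

section Regular

variable {k : ℝ}

lemma isOpen_confocalDomain (hk : k ^ 2 < 1) : IsOpen (confocalDomain k) := by
  have hS := (contDiff_jacobiSn hk).continuous
  have hC := (contDiff_jacobiCn hk).continuous
  exact (isOpen_ne_fun (hC.comp (continuous_apply 1)) continuous_const).inter
    (isOpen_ne_fun (hS.comp (continuous_apply 2)) continuous_const)

lemma isOpen_confocalRegular (hk : k ^ 2 < 1) : IsOpen (confocalRegular k) := by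
  have hS := (contDiff_jacobiSn hk).continuous
  have hC := (contDiff_jacobiCn hk).continuous
  have h : confocalRegular k = confocalDomain k ∩
      {s | (k ^ 2 * jacobiCn k (s 1) ^ 2 + (1 - k ^ 2)) * jacobiSn k (s 2) ^ 2 ≠
        jacobiCn k (s 1) ^ 2} := by
    ext s
    refine and_congr_right fun ⟨h1, h2⟩ => not_congr ?_
    field_simp
  rw [h]
  exact (isOpen_confocalDomain hk).inter (isOpen_ne_fun (by fun_prop) (by fun_prop))

lemma exists_equiv_hasStrictFDerivAt_confocalMap (hk : k ^ 2 < 1) {s : Fin 3 → ℝ}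
    (hs : s ∈ confocalRegular k) : ∃ e : (Fin 3 → ℝ) ≃L[ℝ] EuclideanSpace ℝ (Fin 3),
      HasStrictFDerivAt (confocalMap k) (e : (Fin 3 → ℝ) →L[ℝ] EuclideanSpace ℝ (Fin 3)) s := by
  obtain ⟨e, he⟩ := exists_continuousLinearEquiv_of_injective (by simp)
    (injective_fderiv_confocalMap hk hs)
  exact ⟨e, he ▸ (contDiffAt_confocalMap hk hs.1).hasStrictFDerivAt (by simp)⟩

lemma exists_injOn_confocalMap (hk : k ^ 2 < 1) {s : Fin 3 → ℝ} (hs : s ∈ confocalRegular k) :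
    ∃ V : Set (Fin 3 → ℝ), IsOpen V ∧ s ∈ V ∧ V ⊆ confocalRegular k ∧
      Set.InjOn (confocalMap k) V := by
  obtain ⟨e, he⟩ := exists_equiv_hasStrictFDerivAt_confocalMap hk hs
  refine ⟨(he.toOpenPartialHomeomorph _).source ∩ confocalRegular k,
    (he.toOpenPartialHomeomorph _).open_source.inter (isOpen_confocalRegular hk),
    ⟨he.mem_toOpenPartialHomeomorph_source, hs⟩, Set.inter_subset_right, ?_⟩
  exact (he.toOpenPartialHomeomorph _).injOn.mono Set.inter_subset_left

lemma isOpen_image_confocalMap (hk : k ^ 2 < 1) {V : Set (Fin 3 → ℝ)} (hV : IsOpen V)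
    (hVU : V ⊆ confocalRegular k) : IsOpen (confocalMap k '' V) := by
  rw [isOpen_iff_mem_nhds]
  rintro _ ⟨s, hs, rfl⟩
  obtain ⟨e, he⟩ := exists_equiv_hasStrictFDerivAt_confocalMap hk (hVU hs)
  rw [← he.map_nhds_eq_of_equiv]
  exact Filter.image_mem_map (hV.mem_nhds hs)

end Regular

/-! ### The planes and the octahedral web -/

section Web

variable {k : ℝ}

/-- The sign of the horizontal part of the normal of the planes of the `m`-th family. -/
def webSign : Fin 4 → ℝ := ![1, 1, -1, -1]

/-- The coefficient of `dn` in the equation of the planes of the `m`-th family. -/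
def webOffset : Fin 4 → ℝ := ![-1, 1, 1, -1]

/-- The normal of the plane `webPlane k m l`, with last coordinate `1`. -/
noncomputable def webNormal (k : ℝ) (m : Fin 4) (l : ℝ) : EuclideanSpace ℝ (Fin 3) :=
  !₂[webSign m * jacobiCn k l, -(webSign m * jacobiSn k l), 1]

lemma webSign_sq (m : Fin 4) : webSign m ^ 2 = 1 := by fin_cases m <;> simp [webSign]

lemma webOffset_sq (m : Fin 4) : webOffset m ^ 2 = 1 := by fin_cases m <;> simp [webOffset]

lemma webNormal_ne_zero (m : Fin 4) (l : ℝ) : webNormal k m l ≠ 0 := fun h => by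
  simpa [webNormal] using congrArg (fun p : EuclideanSpace ℝ (Fin 3) => p 2) h

lemma inner_webNormal (m : Fin 4) (l : ℝ) (p : EuclideanSpace ℝ (Fin 3)) :
    inner ℝ (webNormal k m l) p =
      webSign m * (p 0 * jacobiCn k l - p 1 * jacobiSn k l) + p 2 := by
  simp [PiLp.inner_apply, Fin.sum_univ_three, webNormal]
  ring

lemma mem_webPlane_iff {m : Fin 4} {l : ℝ} {p : EuclideanSpace ℝ (Fin 3)} : p ∈ webPlane k m l ↔
    webSign m * (p 0 * jacobiCn k l - p 1 * jacobiSn k l) + p 2 = webOffset m * jacobiDn k l := by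
  fin_cases m <;> simp [webPlane, webSign, webOffset] <;> constructor <;> intro h <;> linarith

lemma webPlane_eq (m : Fin 4) (l : ℝ) :
    webPlane k m l = {p | inner ℝ (webNormal k m l) p = webOffset m * jacobiDn k l} := by
  ext p
  rw [mem_webPlane_iff, Set.mem_ofPred_eq, inner_webNormal]

/-- Each of the four incidences is the four-term identity up to the signs of `s₂` and `s₃`. -/
lemma confocalMap_mem_webPlane (hk : k ^ 2 < 1) {s : Fin 3 → ℝ} (hs : s ∈ confocalDomain k)
    (m : Fin 4) : confocalMap k s ∈ webPlane k m (webParam m s) := by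
  obtain ⟨h2, h3⟩ := hs
  fin_cases m
  · have h := jacobi_four_term hk (s 0) (s 1) (s 2)
    simp [webPlane, webParam, confocalMap]
    field_simp
    linear_combination h
  · have h := jacobi_four_term hk (s 0) (s 1) (-s 2)
    simp only [jacobiSn_neg hk, jacobiCn_neg hk, jacobiDn_neg hk, ← sub_eq_add_neg] at h
    simp [webPlane, webParam, confocalMap]
    field_simp
    linear_combination h
  · have h := jacobi_four_term hk (s 0) (-s 1) (s 2)
    simp only [jacobiSn_neg hk, jacobiCn_neg hk, jacobiDn_neg hk, ← sub_eq_add_neg] at h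
    simp [webPlane, webParam, confocalMap]
    field_simp
    linear_combination -h
  · have h := jacobi_four_term hk (s 0) (-s 1) (-s 2)
    simp only [jacobiSn_neg hk, jacobiCn_neg hk, jacobiDn_neg hk, ← sub_eq_add_neg] at h
    simp [webPlane, webParam, confocalMap]
    field_simp
    linear_combination -h

/-- `webParam` as continuous linear functionals. -/
noncomputable def webForm (m : Fin 4) : (Fin 3 → ℝ) →L[ℝ] ℝ :=
  ContinuousLinearMap.proj 0 + (![1, 1, -1, -1] m : ℝ) • ContinuousLinearMap.proj 1 +
    (![1, -1, 1, -1] m : ℝ) • ContinuousLinearMap.proj 2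

lemma webForm_apply (m : Fin 4) (s : Fin 3 → ℝ) : webForm m s = webParam m s := by
  fin_cases m <;> simp [webForm, webParam] <;> ring

/-- The only relation between the four parameters is `λ₁ + λ₄ = λ₂ + λ₃`. -/
lemma webParam_of_add_eq_add {l : Fin 4 → ℝ} (h : l 0 + l 3 = l 1 + l 2) (m : Fin 4) :
    webParam m ![(l 0 + l 3) / 2, (l 0 - l 2) / 2, (l 0 - l 1) / 2] = l m := by
  fin_cases m <;> simp [webParam] <;> linarith

/-- The dual bases of the four triples of forms. -/
lemma exists_webForm_dual {i j : Fin 4} (hij : i ≠ j) :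
    ∃ w : Fin 3 → ℝ, webForm i w = 1 ∧ ∀ i', i' ≠ i → i' ≠ j → webForm i' w = 0 := by
  -- the value at `w` of the `j`-th form is determined by the relation between the four forms
  have h : ∃ t : ℝ, ∀ l : Fin 4 → ℝ, l = Function.update (Pi.single i 1) j t →
      l 0 + l 3 = l 1 + l 2 := by
    refine ⟨if i.val + j.val = 3 then -1 else 1, ?_⟩
    rintro l rfl
    fin_cases i <;> fin_cases j <;> simp [Function.update, Pi.single] at hij ⊢
  obtain ⟨t, ht⟩ := h
  have hw (m : Fin 4) := webParam_of_add_eq_add (ht _ rfl) m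
  simp only [← webForm_apply] at hw
  refine ⟨_, (hw i).trans (by simp [hij]), fun i' hi hj => (hw i').trans (by simp [hi, hj])⟩

lemma linearIndependent_webForm (j : Fin 4) :
    LinearIndependent ℝ fun i : {i : Fin 4 // i ≠ j} => webForm i := by
  rw [Fintype.linearIndependent_iff]
  intro c hc i
  obtain ⟨w, hw, hw'⟩ := exists_webForm_dual i.2
  have h := congrArg (fun L : (Fin 3 → ℝ) →L[ℝ] ℝ => L w) hc
  rw [sum_apply, Finset.sum_eq_single i] at h
  · simpa [hw] using h
  · intro b _ hb
    simp [hw' b (fun h => hb (Subtype.ext h)) b.2]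
  · simp

lemma eq_of_webParam_eq {s t : Fin 3 → ℝ} (j : Fin 4)
    (h : ∀ i, i ≠ j → webParam i s = webParam i t) : s = t := by
  have h' : s 0 = t 0 ∧ s 1 = t 1 ∧ s 2 = t 2 := by
    have h0 := h 0
    have h1 := h 1
    have h2 := h 2
    have h3 := h 3
    fin_cases j <;> simp [webParam] at h0 h1 h2 h3 <;>
      refine ⟨by linarith, by linarith, by linarith⟩
  ext i
  fin_cases i
  exacts [h'.1, h'.2.1, h'.2.2]

section Inverse

variable {V : Set (Fin 3 → ℝ)}

/-- The confocal coordinates as functions on the image of `V`. -/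
noncomputable def confocalCoord (k : ℝ) (V : Set (Fin 3 → ℝ)) :
    EuclideanSpace ℝ (Fin 3) → Fin 3 → ℝ :=
  Function.invFunOn (confocalMap k) V

lemma confocalCoord_confocalMap (hinj : Set.InjOn (confocalMap k) V) {s : Fin 3 → ℝ}
    (hs : s ∈ V) : confocalCoord k V (confocalMap k s) = s :=
  hinj.leftInvOn_invFunOn hs

lemma contDiffAt_confocalCoord (hk : k ^ 2 < 1) (hV : IsOpen V) (hVU : V ⊆ confocalRegular k)
    (hinj : Set.InjOn (confocalMap k) V) {s : Fin 3 → ℝ} (hs : s ∈ V) :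
    ContDiffAt ℝ ∞ (confocalCoord k V) (confocalMap k s) := by
  obtain ⟨e, he⟩ := exists_equiv_hasStrictFDerivAt_confocalMap hk (hVU hs)
  exact contDiffAt_of_leftInvOn hV hs (contDiffAt_confocalMap hk (hVU hs).1) he.hasFDerivAt
    fun t ht => confocalCoord_confocalMap hinj ht

lemma fderiv_comp_confocalCoord (hk : k ^ 2 < 1) (hV : IsOpen V) (hVU : V ⊆ confocalRegular k)
    (hinj : Set.InjOn (confocalMap k) V) {s : Fin 3 → ℝ} (hs : s ∈ V)
    (ℓ : (Fin 3 → ℝ) →L[ℝ] ℝ) :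
    (fderiv ℝ (fun p => ℓ (confocalCoord k V p)) (confocalMap k s)).comp
      (fderiv ℝ (confocalMap k) s) = ℓ := by
  have hd : DifferentiableAt ℝ (fun p => ℓ (confocalCoord k V p)) (confocalMap k s) :=
    ℓ.differentiableAt.comp _
      ((contDiffAt_confocalCoord hk hV hVU hinj hs).differentiableAt (by simp))
  have hr := (contDiffAt_confocalMap hk (hVU hs).1).differentiableAt (by simp)
  refine (hd.hasFDerivAt.comp s hr.hasFDerivAt).unique
    (ℓ.hasFDerivAt.congr_of_eventuallyEq ?_)
  filter_upwards [hV.mem_nhds hs] with t ht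
  simp [confocalCoord_confocalMap hinj ht]

lemma isLevelFoliation_confocalCoord (hk : k ^ 2 < 1) (hV : IsOpen V)
    (hVU : V ⊆ confocalRegular k) (hinj : Set.InjOn (confocalMap k) V)
    {ℓ : (Fin 3 → ℝ) →L[ℝ] ℝ} (hℓ : ℓ ≠ 0) :
    IsLevelFoliation (confocalMap k '' V) (fun p => ℓ (confocalCoord k V p))
      (fun c => confocalMap k '' {s | s ∈ V ∧ ℓ s = c}) := by
  refine ⟨?_, ?_, fun c => ?_⟩
  · rintro _ ⟨s, hs, rfl⟩
    exact (ℓ.contDiff.contDiffAt.comp _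
      (contDiffAt_confocalCoord hk hV hVU hinj hs)).contDiffWithinAt
  · rintro _ ⟨s, hs, rfl⟩ h0
    have := fderiv_comp_confocalCoord hk hV hVU hinj hs ℓ
    rw [h0, ContinuousLinearMap.zero_comp] at this
    exact hℓ this.symm
  · ext p
    constructor
    · rintro ⟨s, ⟨hs, hc⟩, rfl⟩
      refine ⟨⟨s, hs, rfl⟩, ?_⟩
      simpa [confocalCoord_confocalMap hinj hs] using hc
    · rintro ⟨⟨s, hs, rfl⟩, hc⟩
      refine ⟨s, ⟨hs, ?_⟩, rfl⟩
      simpa [confocalCoord_confocalMap hinj hs] using hc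

/-- The diagonal surfaces are the coordinate surfaces: if a coordinate is a linear combination of
two of the forms `webParam`, then it is constant on the intersection of two of their level surfaces. -/
lemma image_inter_image_subset (hinj : Set.InjOn (confocalMap k) V) {i j : Fin 4} {n : Fin 3}
    {α β : ℝ} (h : ∀ s, s n = α * webParam i s + β * webParam j s) (c d : ℝ) :
    ∃ e, confocalMap k '' {s | s ∈ V ∧ webParam i s = c} ∩
      confocalMap k '' {s | s ∈ V ∧ webParam j s = d} ⊆
        confocalMap k ''
          {s | s ∈ V ∧ (ContinuousLinearMap.proj n : (Fin 3 → ℝ) →L[ℝ] ℝ) s = e} := by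
  refine ⟨α * c + β * d, ?_⟩
  rintro _ ⟨⟨s, ⟨hs, hc⟩, rfl⟩, ⟨t, ⟨ht, hd⟩, hts⟩⟩
  obtain rfl := hinj ht hs hts
  exact ⟨t, ⟨ht, by simp [h, hc, hd]⟩, rfl⟩

lemma isOctahedralWeb_confocalMap (hk : k ^ 2 < 1) (hV : IsOpen V) (hVne : V.Nonempty)
    (hVU : V ⊆ confocalRegular k) (hinj : Set.InjOn (confocalMap k) V) :
    IsOctahedralWeb (confocalMap k '' V)
      (fun m l => confocalMap k '' {s | s ∈ V ∧ webParam m s = l}) := by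
  have hproj (n : Fin 3) : (ContinuousLinearMap.proj n : (Fin 3 → ℝ) →L[ℝ] ℝ) ≠ 0 := fun h => by
    simpa using congrArg (fun L : (Fin 3 → ℝ) →L[ℝ] ℝ => L (Pi.single n 1)) h
  have hfol (n : Fin 3) := isLevelFoliation_confocalCoord hk hV hVU hinj (hproj n)
  refine ⟨isOpen_image_confocalMap hk hV hVU, hVne.image _,
    ⟨fun i p => webForm i (confocalCoord k V p), fun i => ?_, fun j => ⟨?_, ?_⟩⟩,
    _, _, _, ⟨_, hfol 2⟩, ⟨_, hfol 0⟩, ⟨_, hfol 1⟩, fun c d =>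
    ⟨image_inter_image_subset hinj (α := 1 / 2) (β := -(1 / 2)) ?_ c d,
    image_inter_image_subset hinj (α := 1 / 2) (β := -(1 / 2)) ?_ c d,
    image_inter_image_subset hinj (α := 1 / 2) (β := 1 / 2) ?_ c d,
    image_inter_image_subset hinj (α := 1 / 2) (β := 1 / 2) ?_ c d,
    image_inter_image_subset hinj (α := 1 / 2) (β := -(1 / 2)) ?_ c d,
    image_inter_image_subset hinj (α := 1 / 2) (β := -(1 / 2)) ?_ c d⟩⟩
  · obtain ⟨j, hj⟩ := exists_ne i
    obtain ⟨w, hw, -⟩ := exists_webForm_dual hj.symm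
    have h0 : webForm i ≠ 0 := fun h => by simp [h] at hw
    simpa only [webForm_apply] using isLevelFoliation_confocalCoord hk hV hVU hinj h0
  · rintro _ ⟨s, hs, rfl⟩ _ ⟨t, ht, rfl⟩ hst
    refine congrArg _ (eq_of_webParam_eq j fun i hi => ?_)
    simpa [confocalCoord_confocalMap hinj hs, confocalCoord_confocalMap hinj ht,
      webForm_apply] using congrFun hst ⟨i, hi⟩
  · rintro _ ⟨s, hs, rfl⟩
    refine LinearIndependent.of_comp (((ContinuousLinearMap.compL ℝ (Fin 3 → ℝ)
      (EuclideanSpace ℝ (Fin 3)) ℝ).flip (fderiv ℝ (confocalMap k) s)).toLinearMap) ?_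
    have h : LinearIndependent ℝ fun i : {i : Fin 4 // i ≠ j} =>
        (fderiv ℝ (fun p => webForm i (confocalCoord k V p)) (confocalMap k s)).comp
          (fderiv ℝ (confocalMap k) s) := by
      simp only [fderiv_comp_confocalCoord hk hV hVU hinj hs]
      exact linearIndependent_webForm j
    exact h
  all_goals
    intro s
    simp only [webParam]
    ring

lemma exists_isOpen_image_eq_inter_webPlane (hk : k ^ 2 < 1) (hV : IsOpen V)
    (hVU : V ⊆ confocalRegular k) (m : Fin 4) (l : ℝ) :
    ∃ O : Set (EuclideanSpace ℝ (Fin 3)), IsOpen O ∧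
      confocalMap k '' {s | s ∈ V ∧ webParam m s = l} = O ∩ webPlane k m l := by
  refine ⟨⋃₀ {O | IsOpen O ∧
    O ∩ webPlane k m l ⊆ confocalMap k '' {s | s ∈ V ∧ webParam m s = l}},
    isOpen_sUnion fun O hO => hO.1, Set.Subset.antisymm ?_ ?_⟩
  · rintro _ ⟨s, ⟨hs, hl⟩, rfl⟩
    obtain ⟨e, he⟩ := exists_equiv_hasStrictFDerivAt_confocalMap hk (hVU hs)
    obtain ⟨j, hj⟩ := exists_ne m
    obtain ⟨w, hw, -⟩ := exists_webForm_dual hj.symm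
    obtain ⟨O, hO, hsO, hsub⟩ := exists_isOpen_inter_hyperplane_subset_image he hw
      (webNormal_ne_zero (k := k) m l) (l := l) (h := webOffset m * jacobiDn k l)
      (by rwa [webForm_apply]) (by
        filter_upwards [(isOpen_confocalDomain hk).mem_nhds (hVU hs).1] with t ht htl
        have := confocalMap_mem_webPlane hk ht m
        rw [webForm_apply] at htl
        rwa [htl, webPlane_eq] at this) (hV.mem_nhds hs)
    simp only [webForm_apply, ← webPlane_eq] at hsub
    refine ⟨⟨O, ⟨hO, hsub⟩, hsO⟩, ?_⟩
    rw [← hl]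
    exact confocalMap_mem_webPlane hk (hVU hs).1 m
  · rintro p ⟨⟨O, hO, hpO⟩, hp⟩
    exact hO.2 ⟨hpO, hp⟩

end Inverse

end Web

/-! ### Tangency of the planes with the quadrics and with vertical cones -/

section Tangency

variable {k : ℝ}

/-- A hyperplane with normal `n` through a point of a hypersurface with gradient a nonzero multiple
of `n` is tangent to the hypersurface. -/
lemma isTangentTo_of_hasFDerivAt {d : ℕ} {q : EuclideanSpace ℝ (Fin d) → ℝ}
    {p n : EuclideanSpace ℝ (Fin d)} {t h c : ℝ} (hq : HasFDerivAt q (t • innerSL ℝ n) p)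
    (ht : t ≠ 0) (hn : n ≠ 0) (hc : q p = c) (hp : inner ℝ n p = h) :
    IsTangentTo {x | inner ℝ n x = h} q c := by
  refine ⟨p, hc, ?_, ?_⟩
  · rw [hq.fderiv]
    intro h0
    have := congrArg (fun L : EuclideanSpace ℝ (Fin d) →L[ℝ] ℝ => L n) h0
    simp [ht, hn] at this
  · ext x
    rw [hq.fderiv]
    simp [ht, inner_sub_right, hp, sub_eq_zero]

lemma isTangentTo_confocalForm {a b c : ℝ} (hk : k ^ 2 < 1) (hac : a - c = 1)
    (hab : a - b = k ^ 2) (m : Fin 4) (l : ℝ) {μ : ℝ} (ha : μ + a ≠ 0) (hb : μ + b ≠ 0)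
    (hc : μ + c ≠ 0) : IsTangentTo (webPlane k m l) (confocalForm a b c μ) 1 := by
  have hd := (jacobiDn_pos hk l).ne'
  have h1 := jacobiSn_sq_add_jacobiCn_sq (k := k) l
  have h2 := jacobiDn_sq hk l
  have hσ := webSign_sq m
  have hρ := webOffset_sq m
  have hρ0 : webOffset m ≠ 0 := fun h => by simp [h] at hρ
  -- the point of contact is the pole of the plane
  set p : EuclideanSpace ℝ (Fin 3) :=
    !₂[(μ + a) * (webSign m * jacobiCn k l) / (webOffset m * jacobiDn k l),
      -((μ + b) * (webSign m * jacobiSn k l)) / (webOffset m * jacobiDn k l),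
      -(μ + c) / (webOffset m * jacobiDn k l)] with hp
  rw [webPlane_eq]
  refine isTangentTo_of_hasFDerivAt (p := p) (t := 2 / (webOffset m * jacobiDn k l)) ?_
    (by positivity) (webNormal_ne_zero m l) ?_ ?_
  · have hx (i : Fin 3) := ((EuclideanSpace.proj i :
      EuclideanSpace ℝ (Fin 3) →L[ℝ] ℝ).hasFDerivAt (x := p)).pow 2
    refine ((((hx 0).mul_const (μ + a)⁻¹).add ((hx 1).mul_const (μ + b)⁻¹)).sub
      ((hx 2).mul_const (μ + c)⁻¹)).congr_fderiv ?_
    ext v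
    simp [hp, inner_webNormal]
    field_simp
    ring
  · simp [confocalForm, hp]
    field_simp
    grind
  · rw [inner_webNormal]
    simp [hp]
    field_simp
    grind

lemma norm_webNormal (m : Fin 4) (l : ℝ) : ‖webNormal k m l‖ = Real.sqrt 2 := by
  have h : jacobiCn k l ^ 2 + jacobiSn k l ^ 2 = 1 := by
    rw [add_comm]
    exact jacobiSn_sq_add_jacobiCn_sq l
  simp [EuclideanSpace.norm_eq, Fin.sum_univ_three, webNormal, mul_pow, webSign_sq, h]
  norm_num

lemma meetAtAngle_webPlane (m : Fin 4) (l : ℝ) :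
    MeetAtAngle (webPlane k m l) {p | p 2 = 0} (Real.pi / 4) := by
  have h1 := jacobiSn_sq_add_jacobiCn_sq (k := k) l
  have hσ := webSign_sq m
  refine ⟨!₂[webOffset m * webSign m * jacobiDn k l * jacobiCn k l,
    -(webOffset m * webSign m * jacobiDn k l * jacobiSn k l), 0], webNormal k m l,
    !₂[0, 0, 1], webNormal_ne_zero m l, fun h => ?_, ?_, ?_, ?_⟩
  · simpa using congrArg (fun p : EuclideanSpace ℝ (Fin 3) => p 2) h
  · rw [webPlane_eq]
    ext x
    simp only [Set.mem_ofPred_eq, inner_sub_right, sub_eq_zero]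
    convert Iff.rfl using 2
    rw [inner_webNormal]
    simp
    linear_combination (webOffset m * jacobiDn k l) * hσ +
      (webOffset m * webSign m ^ 2 * jacobiDn k l) * h1
  · ext x
    simp [PiLp.inner_apply, Fin.sum_univ_three]
  · have h : (|inner ℝ (webNormal k m l) !₂[0, 0, 1]| /
        (‖webNormal k m l‖ * ‖(!₂[0, 0, 1] : EuclideanSpace ℝ (Fin 3))‖)) =
        Real.cos (Real.pi / 4) := by
      rw [norm_webNormal, inner_webNormal, Real.cos_pi_div_four]
      simp [EuclideanSpace.norm_eq, Fin.sum_univ_three]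
      field_simp
      simp
    rw [h, Real.arccos_cos (by positivity) (by linarith [Real.pi_pos])]

lemma hasFDerivAt_coneForm (v w p : EuclideanSpace ℝ (Fin 3)) (α : ℝ) :
    HasFDerivAt (coneForm v w α)
      (innerSL ℝ ((2 * inner ℝ w (p - v)) • w - (2 * Real.cos α ^ 2) • (p - v))) p := by
  have h : HasFDerivAt (fun x : EuclideanSpace ℝ (Fin 3) => x - v)
      (ContinuousLinearMap.id ℝ _) p := (hasFDerivAt_id p).sub_const v
  refine ((((innerSL ℝ w).hasFDerivAt.comp p h).pow 2).sub
    (h.norm_sq.const_mul (Real.cos α ^ 2))).congr_fderiv ?_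
  ext x
  simp
  ring

/-- The planes include equal angles with the vertical direction, so that four of them with a common
point touch the cone with vertical axis and half-opening angle 45 degrees. -/
lemma isVertexOfTouchingCone_of_mem {v : EuclideanSpace ℝ (Fin 3)} {l : Fin 4 → ℝ}
    (hv : ∀ m, v ∈ webPlane k m (l m)) :
    IsVertexOfTouchingCone v fun m => webPlane k m (l m) := by
  have hw : ‖(!₂[0, 0, 1] : EuclideanSpace ℝ (Fin 3))‖ = 1 := by
    simp [EuclideanSpace.norm_eq, Fin.sum_univ_three]
  have hcos : Real.cos (Real.pi / 4) ^ 2 = 1 / 2 := by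
    rw [Real.cos_pi_div_four, div_pow, Real.sq_sqrt zero_le_two]
    norm_num
  refine ⟨!₂[0, 0, 1], Real.pi / 4, hw, by positivity, by linarith [Real.pi_pos], fun m => ?_⟩
  set n := webNormal k m (l m) with hn
  set w : EuclideanSpace ℝ (Fin 3) := !₂[0, 0, 1] with hw'
  have hww : inner ℝ w w = (1 : ℝ) := by rw [real_inner_self_eq_norm_sq, hw, one_pow]
  have hnn : inner ℝ n n = (2 : ℝ) := by
    rw [real_inner_self_eq_norm_sq, norm_webNormal, Real.sq_sqrt zero_le_two]
  have hnw : inner ℝ n w = (1 : ℝ) := by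
    rw [inner_webNormal]
    simp [hw']
  have hwn : inner ℝ w n = (1 : ℝ) := by rw [real_inner_comm, hnw]
  have hv' := hv m
  dsimp only
  rw [webPlane_eq] at hv' ⊢
  -- the line of contact has direction `n - 2 w`
  refine isTangentTo_of_hasFDerivAt (p := v + (n - (2 : ℝ) • w)) (t := -1) ?_ (by norm_num)
    (webNormal_ne_zero m _) ?_ ?_
  · refine (hasFDerivAt_coneForm v w _ _).congr_fderiv ?_
    ext x
    simp only [add_sub_cancel_left, hcos, innerSL_apply_apply, inner_sub_left, inner_smul_left,
      inner_sub_right, inner_smul_right, hwn, hww]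
    simp [← hn]
    ring
  · simp only [coneForm, add_sub_cancel_left, hcos, ← real_inner_self_eq_norm_sq, inner_sub_left,
      inner_smul_left, inner_sub_right, inner_smul_right, hwn, hww, hnw, hnn]
    simp
    norm_num
  · have : inner ℝ n v = webOffset m * jacobiDn k (l m) := hv'
    rw [← hn, inner_add_right, this, inner_sub_right, inner_smul_right, hnn, hnw]
    ring

end Tangency

/-! ### Common points of four planes -/

section CommonPoint

variable {k : ℝ}

/-- Where `cn s₂ = 0` or `sn s₃ = 0`, two of the four planes are parallel and distinct. -/
lemma mem_confocalDomain_of_mem_webPlane (hk : k ^ 2 < 1) {s : Fin 3 → ℝ}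
    {p : EuclideanSpace ℝ (Fin 3)} (hp : ∀ m, p ∈ webPlane k m (webParam m s)) :
    s ∈ confocalDomain k := by
  have h0 := hp 0
  have h1 := hp 1
  have h2 := hp 2
  simp only [webPlane, webParam, Set.mem_ofPred_eq] at h0 h1 h2
  constructor
  · intro hc
    obtain ⟨e1, e2, e3⟩ := jacobi_add_eq_of_jacobiCn_eq_zero hk hc (s 0 + s 2)
    rw [show s 0 + s 1 + s 2 = s 0 + s 2 + s 1 by ring, e1, e2, e3] at h0
    rw [show s 0 - s 1 + s 2 = s 0 + s 2 - s 1 by ring] at h2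
    linarith [jacobiDn_pos hk (s 0 + s 2 - s 1)]
  · intro hc
    obtain ⟨e1, e2, e3⟩ := jacobi_add_eq_of_jacobiSn_eq_zero hk hc (s 0 + s 1)
    rw [e1, e2, e3] at h0
    linarith [jacobiDn_pos hk (s 0 + s 1 - s 2)]

/-- A line and a circle have at most two common points. -/
lemma eq_or_eq_of_mem_line_of_mem_circle {u v w c₀ s₀ c₁ s₁ c s : ℝ} (huv : u ≠ 0 ∨ v ≠ 0)
    (hne : ¬(s₀ = s₁ ∧ c₀ = c₁)) (h₀ : s₀ ^ 2 + c₀ ^ 2 = 1) (h₁ : s₁ ^ 2 + c₁ ^ 2 = 1)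
    (h : s ^ 2 + c ^ 2 = 1) (l₀ : u * c₀ - v * s₀ + w = 0) (l₁ : u * c₁ - v * s₁ + w = 0)
    (l : u * c - v * s + w = 0) : (s₀ = s ∧ c₀ = c) ∨ (s₁ = s ∧ c₁ = c) := by
  have hN : u ^ 2 + v ^ 2 ≠ 0 := by rcases huv with h | h <;> positivity
  -- the points of the line as `(c₀, s₀) + t (v, u)`
  have param {C S : ℝ} (hL : u * C - v * S + w = 0) :
      ∃ t, C = c₀ + t * v ∧ S = s₀ + t * u := by
    refine ⟨(v * (C - c₀) + u * (S - s₀)) / (u ^ 2 + v ^ 2), ?_, ?_⟩ <;> field_simp <;> grind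
  obtain ⟨t₁, rfl, rfl⟩ := param l₁
  obtain ⟨t, rfl, rfl⟩ := param l
  have ht₁ : t₁ ≠ 0 := fun h0 => hne (by simp [h0])
  by_cases ht : t = 0
  · exact Or.inl (by simp [ht])
  · have e₁ : 2 * (c₀ * v + s₀ * u) + t₁ * (u ^ 2 + v ^ 2) = 0 :=
      (mul_eq_zero.1 (by linear_combination h₁ - h₀ : t₁ * _ = 0)).resolve_left ht₁
    have e : 2 * (c₀ * v + s₀ * u) + t * (u ^ 2 + v ^ 2) = 0 :=
      (mul_eq_zero.1 (by linear_combination h - h₀ : t * _ = 0)).resolve_left ht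
    have : t₁ = t := mul_right_cancel₀ hN (by linarith)
    exact Or.inr (by simp [this])

/-- The normals of four related planes span the space, unless the four points of the unit circle
given by their horizontal parts coincide in pairs. -/
lemma eq_of_mem_webPlane (hk : k ^ 2 < 1) {s : Fin 3 → ℝ} (hs : s ∈ confocalDomain k)
    (hne : jacobiSn k (s 1) ≠ 0 ∨ jacobiCn k (s 2) ≠ 0) {p q : EuclideanSpace ℝ (Fin 3)}
    (hp : ∀ m, p ∈ webPlane k m (webParam m s)) (hq : ∀ m, q ∈ webPlane k m (webParam m s)) :
    p = q := by
  obtain ⟨h2, h3⟩ := hs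
  have e (m : Fin 4) : webSign m * ((p 0 - q 0) * jacobiCn k (webParam m s) -
      (p 1 - q 1) * jacobiSn k (webParam m s)) + (p 2 - q 2) = 0 := by
    linear_combination mem_webPlane_iff.1 (hp m) - mem_webPlane_iff.1 (hq m)
  have e0 := e 0
  have e1 := e 1
  have e2 := e 2
  have e3 := e 3
  simp [webSign] at e0 e1 e2 e3
  suffices huv : p 0 - q 0 = 0 ∧ p 1 - q 1 = 0 by
    rw [huv.1, huv.2] at e0
    ext i
    fin_cases i
    · exact sub_eq_zero.1 huv.1
    · exact sub_eq_zero.1 huv.2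
    · simpa [sub_eq_zero] using e0
  by_contra huv
  rw [not_and_or] at huv
  have circ (x : ℝ) : jacobiSn k x ^ 2 + jacobiCn k x ^ 2 = 1 := jacobiSn_sq_add_jacobiCn_sq x
  have circ' (x : ℝ) : (-jacobiSn k x) ^ 2 + (-jacobiCn k x) ^ 2 = 1 := by
    rw [neg_sq, neg_sq, circ]
  have h01 : ¬(jacobiSn k (webParam 0 s) = jacobiSn k (webParam 1 s) ∧
      jacobiCn k (webParam 0 s) = jacobiCn k (webParam 1 s)) := fun h =>
    h3 (jacobiSn_eq_zero_of_eq hk (u := s 0 + s 1) h.1 h.2)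
  have h12 : jacobiCn k (s 1 - s 2) = 0 := by
    rcases eq_or_eq_of_mem_line_of_mem_circle huv h01 (circ _) (circ _) (circ' (webParam 2 s)) e0 e1
      (by linarith) with h | h
    · refine absurd (jacobiCn_eq_zero_of_eq_neg hk (u := s 0 + s 2) (v := s 1) ?_ ?_) h2
      · convert h.1 using 2 <;> simp only [webParam] <;> ring_nf
      · convert h.2 using 2 <;> simp only [webParam] <;> ring_nf
    · refine jacobiCn_eq_zero_of_eq_neg hk (u := s 0) ?_ ?_
      · convert h.1 using 2 <;> simp only [webParam] <;> ring_nf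
      · convert h.2 using 2 <;> simp only [webParam] <;> ring_nf
  have h03 : jacobiCn k (s 1 + s 2) = 0 := by
    rcases eq_or_eq_of_mem_line_of_mem_circle huv h01 (circ _) (circ _) (circ' (webParam 3 s)) e0 e1
      (by linarith) with h | h
    · refine jacobiCn_eq_zero_of_eq_neg hk (u := s 0) ?_ ?_
      · convert h.1 using 2 <;> simp only [webParam] <;> ring_nf
      · convert h.2 using 2 <;> simp only [webParam] <;> ring_nf
    · refine absurd (jacobiCn_eq_zero_of_eq_neg hk (u := s 0 - s 2) (v := s 1) ?_ ?_) h2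
      · convert h.1 using 2 <;> simp only [webParam] <;> ring_nf
      · convert h.2 using 2 <;> simp only [webParam] <;> ring_nf
  obtain ⟨z1, z2⟩ := jacobi_zeros_of_jacobiCn_add_sub_eq_zero hk h2 h3 h03 h12
  exact hne.elim (fun h => h z1) fun h => h z2

end CommonPoint

/-! ### Asymptotic lines and their limits -/

section Asymptotic

variable {k : ℝ}

lemma jacobi_sub_mul_half_period (hk : k ^ 2 < 1) {ε : ℝ} (hε : ε = 1 ∨ ε = -1) (l : ℝ) :
    jacobiSn k (l - ε * ellipticF k Real.pi) = -jacobiSn k l ∧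
      jacobiCn k (l - ε * ellipticF k Real.pi) = -jacobiCn k l ∧
      jacobiDn k (l - ε * ellipticF k Real.pi) = jacobiDn k l := by
  rcases hε with rfl | rfl
  · simpa using jacobi_sub_half_period hk l
  · simpa using jacobi_add_half_period hk l

/-- Two planes with independent horizontal parts of the normals meet in a line, on which the height
is a parameter. -/
lemma exists_line_of_det_ne_zero {a₁ b₁ h₁ a₂ b₂ h₂ : ℝ} (hΔ : a₁ * b₂ - a₂ * b₁ ≠ 0) :
    ∃ p v : EuclideanSpace ℝ (Fin 3), v ≠ 0 ∧ ∀ q : EuclideanSpace ℝ (Fin 3),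
      (q 0 * a₁ - q 1 * b₁ + q 2 = h₁ ∧ -(q 0 * a₂ - q 1 * b₂) + q 2 = h₂) ↔
        ∃ t : ℝ, p + t • v = q := by
  obtain ⟨D, hD⟩ : ∃ D, D = a₁ * b₂ - a₂ * b₁ := ⟨_, rfl⟩
  rw [← hD] at hΔ
  refine ⟨!₂[(h₁ * b₂ + h₂ * b₁) / D, (h₁ * a₂ + h₂ * a₁) / D, 0],
    !₂[-(b₁ + b₂) / D, -(a₁ + a₂) / D, 1], fun h => ?_, fun q => ⟨?_, ?_⟩⟩
  · simpa using congrArg (fun p : EuclideanSpace ℝ (Fin 3) => p 2) h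
  · rintro ⟨e₁, e₂⟩
    refine ⟨q 2, ?_⟩
    ext i
    fin_cases i <;> simp <;> field_simp <;> subst e₁ e₂ hD <;> ring
  · rintro ⟨t, rfl⟩
    constructor <;> simp <;> field_simp <;> grind

/-- The determinant of the horizontal parts of two planes of different families. -/
lemma jacobi_det_ne_zero (hk : k ^ 2 < 1) {v : ℝ} (hs : jacobiSn k v ≠ 0) (hc : jacobiCn k v ≠ 0)
    (u : ℝ) : jacobiCn k (u + v) * jacobiSn k (u - v) -
      jacobiCn k (u - v) * jacobiSn k (u + v) ≠ 0 := by
  intro h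
  have h1 := jacobiSn_sq_add_jacobiCn_sq (k := k) (u + v)
  have h2 := jacobiSn_sq_add_jacobiCn_sq (k := k) (u - v)
  -- the two points of the unit circle are equal or antipodal, by the value of their inner product
  set e := jacobiCn k (u + v) * jacobiCn k (u - v) + jacobiSn k (u + v) * jacobiSn k (u - v) with he
  have e1 : jacobiSn k (u + v) = e * jacobiSn k (u - v) := by
    linear_combination -jacobiSn k (u + v) * h2 - jacobiCn k (u - v) * h
  have e2 : jacobiCn k (u + v) = e * jacobiCn k (u - v) := by
    linear_combination -jacobiCn k (u + v) * h2 + jacobiSn k (u - v) * h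
  have hee : e = 1 ∨ e = -1 := by
    rw [← sq_eq_one_iff]
    rw [e1, e2] at h1
    linear_combination h1 - e ^ 2 * h2
  rcases hee with hee | hee <;> rw [hee] at e1 e2
  · exact hs (jacobiSn_eq_zero_of_eq hk (by simpa using e1) (by simpa using e2))
  · exact hc (jacobiCn_eq_zero_of_eq_neg hk (by simpa using e1) (by simpa using e2))

/-- On a coordinate surface `s₂ = const`, the curve `s₁ + ε s₃ = l` lies in a plane of the first and
one of the third family (`ε = 1`), or of the second and the fourth (`ε = -1`). -/
lemma confocalMap_mem_planes (hk : k ^ 2 < 1) {ε : ℝ} (hε : ε = 1 ∨ ε = -1) {s₁ s₂ s₃ l : ℝ}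
    (h2 : jacobiCn k s₂ ≠ 0) (h3 : jacobiSn k s₃ ≠ 0) (hl : s₁ + ε * s₃ = l) :
    confocalMap k ![s₁, s₂, s₃] 0 * jacobiCn k (l + s₂) -
        confocalMap k ![s₁, s₂, s₃] 1 * jacobiSn k (l + s₂) + confocalMap k ![s₁, s₂, s₃] 2 =
        -ε * jacobiDn k (l + s₂) ∧
      -(confocalMap k ![s₁, s₂, s₃] 0 * jacobiCn k (l - s₂) -
        confocalMap k ![s₁, s₂, s₃] 1 * jacobiSn k (l - s₂)) + confocalMap k ![s₁, s₂, s₃] 2 =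
        ε * jacobiDn k (l - s₂) := by
  have hs : ![s₁, s₂, s₃] ∈ confocalDomain k := ⟨h2, h3⟩
  have h (m : Fin 4) := mem_webPlane_iff.1 (confocalMap_mem_webPlane hk hs m)
  subst hl
  rcases hε with rfl | rfl
  · rw [show s₁ + 1 * s₃ + s₂ = webParam 0 ![s₁, s₂, s₃] by simp [webParam]; ring,
      show s₁ + 1 * s₃ - s₂ = webParam 2 ![s₁, s₂, s₃] by simp [webParam]; ring]
    exact ⟨by simpa [webSign, webOffset] using h 0, by simpa [webSign, webOffset] using h 2⟩
  · rw [show s₁ + -1 * s₃ + s₂ = webParam 1 ![s₁, s₂, s₃] by simp [webParam]; ring,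
      show s₁ + -1 * s₃ - s₂ = webParam 3 ![s₁, s₂, s₃] by simp [webParam]; ring]
    exact ⟨by simpa [webSign, webOffset] using h 1, by simpa [webSign, webOffset] using h 3⟩

lemma exists_line_asymptoticCurve (hk : k ^ 2 < 1) {ε : ℝ} (hε : ε = 1 ∨ ε = -1) (l : ℝ) {s₂ : ℝ}
    (hs : jacobiSn k s₂ ≠ 0) (hc : jacobiCn k s₂ ≠ 0) :
    ∃ p v : EuclideanSpace ℝ (Fin 3), v ≠ 0 ∧
      asymptoticCurve k s₂ ε l = Set.range (fun t : ℝ => p + t • v) := by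
  have hΔ := jacobi_det_ne_zero hk hs hc l
  obtain ⟨p, v, hv, hpv⟩ := exists_line_of_det_ne_zero (h₁ := -ε * jacobiDn k (l + s₂))
    (h₂ := ε * jacobiDn k (l - s₂)) hΔ
  refine ⟨p, v, hv, Set.Subset.antisymm ?_ ?_⟩
  · rintro _ ⟨s₁, s₃, h3, hl, rfl⟩
    exact (hpv _).1 (confocalMap_mem_planes hk hε hc h3 hl)
  · rintro q hq
    obtain ⟨q1, q2⟩ := (hpv q).2 hq
    -- a point of the curve at the height of `q`
    obtain ⟨s₃, h3, hs₃⟩ := exists_eq_mul_jacobiSn hk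
      (f := fun s => jacobiDn k (l - ε * s) * jacobiCn k s)
      (((contDiff_jacobiDn hk).continuous.comp (by fun_prop)).mul (contDiff_jacobiCn hk).continuous)
      (by simp [(jacobi_sub_mul_half_period hk hε l).2.2, jacobi_half_period hk, jacobiCn_zero hk])
      (fun s h0 => mul_ne_zero (jacobiDn_pos hk _).ne' fun h1 => by
        simpa [h0, h1] using jacobiSn_sq_add_jacobiCn_sq (k := k) s)
      (q 2 * jacobiCn k s₂ / jacobiSn k s₂)
    have hl : l - ε * s₃ + ε * s₃ = l := by ring
    refine ⟨l - ε * s₃, s₃, h3, hl, ?_⟩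
    obtain ⟨r1, r2⟩ := confocalMap_mem_planes hk hε hc h3 hl
    have hz : confocalMap k ![l - ε * s₃, s₂, s₃] 2 = q 2 := by
      have : confocalMap k ![l - ε * s₃, s₂, s₃] 2 = jacobiDn k (l - ε * s₃) * jacobiCn k s₃ *
          (jacobiSn k s₂ / jacobiCn k s₂) / jacobiSn k s₃ := by
        simp [confocalMap]
        ring
      rw [this, hs₃]
      field_simp
    set r := confocalMap k ![l - ε * s₃, s₂, s₃] with hr
    rw [hz] at r1 r2
    ext i
    fin_cases i
    · exact mul_right_cancel₀ hΔ (by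
        simp only [Fin.zero_eta]
        linear_combination jacobiSn k (l - s₂) * (q1 - r1) + jacobiSn k (l + s₂) * (q2 - r2))
    · exact mul_right_cancel₀ hΔ (by
        simp only [Fin.mk_one]
        linear_combination jacobiCn k (l - s₂) * (q1 - r1) + jacobiCn k (l + s₂) * (q2 - r2))
    · exact hz.symm

lemma confocalForm_of_mem_asymptoticCurve {a b c : ℝ} (hk : k ^ 2 < 1) (hac : a - c = 1)
    (hab : a - b = k ^ 2) {ε l s₂ : ℝ} (hs : jacobiSn k s₂ ≠ 0) (hc : jacobiCn k s₂ ≠ 0)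
    {p : EuclideanSpace ℝ (Fin 3)} (hp : p ∈ asymptoticCurve k s₂ ε l) :
    confocalForm a b c (-b + (b - c) / jacobiCn k s₂ ^ 2) p = 1 := by
  obtain ⟨s₁, s₃, h3, -, rfl⟩ := hp
  have hd := (jacobiDn_pos hk s₂).ne'
  have hk1 : 1 - k ^ 2 ≠ 0 := (sub_pos.2 hk).ne'
  have c1 := jacobiSn_sq_add_jacobiCn_sq (k := k) s₁
  have c2 := jacobiSn_sq_add_jacobiCn_sq (k := k) s₂
  have c3 := jacobiSn_sq_add_jacobiCn_sq (k := k) s₃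
  have d1 := jacobiDn_sq hk s₁
  have d2 := jacobiDn_sq hk s₂
  have d3 := jacobiDn_sq hk s₃
  obtain rfl : c = a - 1 := by linarith
  obtain rfl : b = a - k ^ 2 := by linarith
  have ea : -(a - k ^ 2) + (a - k ^ 2 - (a - 1)) / jacobiCn k s₂ ^ 2 + a =
      jacobiDn k s₂ ^ 2 / jacobiCn k s₂ ^ 2 := by
    field_simp
    linear_combination -d2 + k ^ 2 * c2
  have eb : -(a - k ^ 2) + (a - k ^ 2 - (a - 1)) / jacobiCn k s₂ ^ 2 + (a - k ^ 2) =
      (1 - k ^ 2) / jacobiCn k s₂ ^ 2 := by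
    field_simp
    ring
  have ec : -(a - k ^ 2) + (a - k ^ 2 - (a - 1)) / jacobiCn k s₂ ^ 2 + (a - 1) =
      (1 - k ^ 2) * jacobiSn k s₂ ^ 2 / jacobiCn k s₂ ^ 2 := by
    field_simp
    linear_combination (k ^ 2 - 1) * c2
  rw [confocalForm, ea, eb, ec]
  simp [confocalMap]
  field_simp
  grind

/-- The limit of the planes containing the asymptotic curves is the line
`x cn l - y sn l = -ε dn l`, a tangent of the ellipse. -/
lemma isTangentTo_planarMap (hk : k ^ 2 < 1) {ε : ℝ} (hε : ε = 1 ∨ ε = -1) (l : ℝ) :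
    IsTangentTo {p | ∃ s₁ s₃ : ℝ, jacobiSn k s₃ ≠ 0 ∧ s₁ + ε * s₃ = l ∧ p = planarMap k s₁ s₃}
      (fun p : EuclideanSpace ℝ (Fin 2) => p 0 ^ 2 + p 1 ^ 2 / (1 - k ^ 2)) 1 := by
  have hd := (jacobiDn_pos hk l).ne'
  have hk1 : 1 - k ^ 2 ≠ 0 := (sub_pos.2 hk).ne'
  have c1 := jacobiSn_sq_add_jacobiCn_sq (k := k) l
  have d1 := jacobiDn_sq hk l
  have hεε : ε ^ 2 = 1 := by rcases hε with rfl | rfl <;> norm_num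
  have hε0 : ε ≠ 0 := fun h => by simp [h] at hεε
  have hinner (p : EuclideanSpace ℝ (Fin 2)) :
      inner ℝ !₂[jacobiCn k l, -jacobiSn k l] p = p 0 * jacobiCn k l - p 1 * jacobiSn k l := by
    simp [PiLp.inner_apply, Fin.sum_univ_two]
    ring
  have hline {s₁ s₃ : ℝ} (h3 : jacobiSn k s₃ ≠ 0) (hl : s₁ + ε * s₃ = l) :
      planarMap k s₁ s₃ 0 * jacobiCn k l - planarMap k s₁ s₃ 1 * jacobiSn k l =
        -ε * jacobiDn k l := by
    have h := jacobi_four_term hk s₁ 0 (ε * s₃)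
    rw [add_zero, hl, jacobiSn_zero hk, jacobiCn_zero hk, jacobiDn_zero hk] at h
    simp [planarMap]
    field_simp
    rcases hε with rfl | rfl
    · simp at h
      linear_combination h
    · simp [jacobiSn_neg hk, jacobiDn_neg hk] at h
      linear_combination h
  have hset : {p | ∃ s₁ s₃ : ℝ, jacobiSn k s₃ ≠ 0 ∧ s₁ + ε * s₃ = l ∧ p = planarMap k s₁ s₃} =
      {p | inner ℝ !₂[jacobiCn k l, -jacobiSn k l] p = -ε * jacobiDn k l} := by
    ext q
    simp only [Set.mem_ofPred_eq, hinner]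
    constructor
    · rintro ⟨s₁, s₃, h3, hl, rfl⟩
      exact hline h3 hl
    · intro hq
      -- the coordinate `x sn l + y cn l` along the line takes every value on the curve
      obtain ⟨s₃, h3, hs₃⟩ := exists_eq_mul_jacobiSn hk
        (f := fun s => jacobiSn k (l - ε * s) * jacobiSn k l +
          jacobiCn k (l - ε * s) * jacobiDn k s * jacobiCn k l)
        ((((contDiff_jacobiSn hk).continuous.comp (by fun_prop)).mul continuous_const).add
          ((((contDiff_jacobiCn hk).continuous.comp (by fun_prop)).mul
            (contDiff_jacobiDn hk).continuous).mul continuous_const))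
        (by
          simp [jacobi_sub_mul_half_period hk hε l, jacobi_half_period hk, jacobiDn_zero hk]
          ring)
        (fun s h0 => by
          have hd : jacobiDn k s = 1 := by simp [jacobiDn, h0]
          have hcs : jacobiCn k s ≠ 0 := fun h1 => by
            simpa [h0, h1] using jacobiSn_sq_add_jacobiCn_sq (k := k) s
          have h : jacobiSn k (l - ε * s) = jacobiSn k l * jacobiCn k s ∧
              jacobiCn k (l - ε * s) = jacobiCn k l * jacobiCn k s := by
            rcases hε with rfl | rfl <;>
              simp [sub_eq_add_neg, jacobiSn_add hk, jacobiCn_add hk, jacobiSn_neg hk,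
                jacobiCn_neg hk, jacobiDn_neg hk, h0, hd]
          simp only [h, hd]
          convert hcs using 1
          linear_combination jacobiCn k s * c1)
        (q 0 * jacobiSn k l + q 1 * jacobiCn k l)
      refine ⟨l - ε * s₃, s₃, h3, by ring, ?_⟩
      have h1 := hline h3 (show l - ε * s₃ + ε * s₃ = l by ring)
      have h2 : planarMap k (l - ε * s₃) s₃ 0 * jacobiSn k l +
          planarMap k (l - ε * s₃) s₃ 1 * jacobiCn k l =
          q 0 * jacobiSn k l + q 1 * jacobiCn k l := by
        refine mul_right_cancel₀ h3 ?_
        rw [← hs₃]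
        simp [planarMap]
        field_simp
      generalize planarMap k (l - ε * s₃) s₃ = r at h1 h2
      ext i
      fin_cases i
      · simp only [Fin.zero_eta]
        linear_combination (r 0 - q 0) * c1 + jacobiCn k l * (hq - h1) - jacobiSn k l * h2
      · simp only [Fin.mk_one]
        linear_combination (r 1 - q 1) * c1 - jacobiSn k l * (hq - h1) - jacobiCn k l * h2
  rw [hset]
  refine isTangentTo_of_hasFDerivAt
    (p := !₂[-ε * jacobiCn k l / jacobiDn k l, ε * (1 - k ^ 2) * jacobiSn k l / jacobiDn k l])
    (t := -2 * ε / jacobiDn k l) ?_ (by simp [hε0, hd]) (fun h => ?_) ?_ ?_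
  · have hx (i : Fin 2) (p : EuclideanSpace ℝ (Fin 2)) := ((EuclideanSpace.proj i :
      EuclideanSpace ℝ (Fin 2) →L[ℝ] ℝ).hasFDerivAt (x := p)).pow 2
    refine ((hx 0 _).add ((hx 1 _).mul_const (1 - k ^ 2)⁻¹)).congr_fderiv ?_
    ext v
    simp [hinner]
    field_simp
    ring
  · have h0 := congrArg (fun p : EuclideanSpace ℝ (Fin 2) => p 0) h
    have h1 := congrArg (fun p : EuclideanSpace ℝ (Fin 2) => p 1) h
    simp at h0 h1
    simp [h0, h1] at c1
  · simp
    field_simp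
    grind
  · rw [hinner]
    simp
    field_simp
    grind

lemma tendsto_confocalMap (hk : k ^ 2 < 1) (s₁ : ℝ) {s₃ : ℝ} (h3 : jacobiSn k s₃ ≠ 0) :
    Filter.Tendsto (fun s₂ : ℝ => confocalMap k ![s₁, s₂, s₃]) (nhds 0)
      (nhds !₂[planarMap k s₁ s₃ 0, planarMap k s₁ s₃ 1, 0]) := by
  have hs : ![s₁, 0, s₃] ∈ confocalDomain k := ⟨by simp [jacobiCn_zero hk], h3⟩
  have hval : confocalMap k ![s₁, 0, s₃] = !₂[planarMap k s₁ s₃ 0, planarMap k s₁ s₃ 1, 0] := by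
    simp [confocalMap, planarMap, jacobiSn_zero hk, jacobiCn_zero hk, jacobiDn_zero hk]
  have hcont : Continuous fun s₂ : ℝ => ![s₁, s₂, s₃] := by fun_prop
  rw [← hval]
  exact (contDiffAt_confocalMap hk hs).continuousAt.tendsto.comp hcont.continuousAt.tendsto

end Asymptotic

theorem mainTheorem9 (a b c k : ℝ) (hk0 : 0 < k) (hk1 : k < 1) (hac : a - c = 1)
    (hab : a - b = k ^ 2) :
    -- the map is a coordinate system near every regular parameter value
    (∀ s ∈ confocalRegular k, ∃ V : Set (Fin 3 → ℝ), IsOpen V ∧ s ∈ V ∧ V ⊆ confocalRegular k ∧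
      Set.InjOn (confocalMap k) V) ∧
    -- the four families of surfaces form an octahedral web and are composed of the planes
    (∀ s ∈ confocalDomain k, ∀ m : Fin 4, confocalMap k s ∈ webPlane k m (webParam m s)) ∧
    (∀ V : Set (Fin 3 → ℝ), IsOpen V → V.Nonempty → V ⊆ confocalRegular k →
      Set.InjOn (confocalMap k) V →
      IsOctahedralWeb (confocalMap k '' V)
        (fun m l => confocalMap k '' {s | s ∈ V ∧ webParam m s = l}) ∧
      ∀ (m : Fin 4) (l : ℝ), ∃ O : Set (EuclideanSpace ℝ (Fin 3)), IsOpen O ∧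
        confocalMap k '' {s | s ∈ V ∧ webParam m s = l} = O ∩ webPlane k m l) ∧
    -- the planes touch all confocal quadrics and meet the plane `z = 0` at 45 degrees
    (∀ (m : Fin 4) (l : ℝ),
      (∀ μ : ℝ, μ + a ≠ 0 → μ + b ≠ 0 → μ + c ≠ 0 →
        IsTangentTo (webPlane k m l) (confocalForm a b c μ) 1) ∧
      MeetAtAngle (webPlane k m l) {p | p 2 = 0} (Real.pi / 4)) ∧
    -- four related planes meet at the vertex of a circular cone touching them
    (∀ l : Fin 4 → ℝ, l 0 + l 3 = l 1 + l 2 →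
      ∀ s : Fin 3 → ℝ, s = ![(l 0 + l 3) / 2, (l 0 - l 2) / 2, (l 0 - l 1) / 2] →
        ((⋂ m, webPlane k m (l m)).Nonempty ↔ s ∈ confocalDomain k) ∧
        (s ∈ confocalDomain k →
          confocalMap k s ∈ (⋂ m, webPlane k m (l m)) ∧
          IsVertexOfTouchingCone (confocalMap k s) (fun m => webPlane k m (l m)) ∧
          (jacobiSn k (s 1) ≠ 0 ∨ jacobiCn k (s 2) ≠ 0 →
            (⋂ m, webPlane k m (l m)) = {confocalMap k s}))) ∧
    -- the asymptotic lines and their limit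
    (∀ ε : ℝ, ε = 1 ∨ ε = -1 → ∀ l : ℝ,
      (∀ s₂ : ℝ, jacobiSn k s₂ ≠ 0 → jacobiCn k s₂ ≠ 0 →
        (∃ p v : EuclideanSpace ℝ (Fin 3), v ≠ 0 ∧
          asymptoticCurve k s₂ ε l = Set.range (fun t : ℝ => p + t • v)) ∧
        ∀ p ∈ asymptoticCurve k s₂ ε l,
          confocalForm a b c (-b + (b - c) / jacobiCn k s₂ ^ 2) p = 1) ∧
      IsTangentTo {p | ∃ s₁ s₃ : ℝ, jacobiSn k s₃ ≠ 0 ∧ s₁ + ε * s₃ = l ∧ p = planarMap k s₁ s₃}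
        (fun p : EuclideanSpace ℝ (Fin 2) => p 0 ^ 2 + p 1 ^ 2 / (1 - k ^ 2)) 1) ∧
    (∀ s₁ s₃ : ℝ, jacobiSn k s₃ ≠ 0 →
      Filter.Tendsto (fun s₂ : ℝ => confocalMap k ![s₁, s₂, s₃]) (nhds 0)
        (nhds !₂[planarMap k s₁ s₃ 0, planarMap k s₁ s₃ 1, 0])) := by
  have hk : k ^ 2 < 1 := by nlinarith
  refine ⟨fun s hs => exists_injOn_confocalMap hk hs,
    fun s hs m => confocalMap_mem_webPlane hk hs m,
    fun V hV hVne hVU hinj => ⟨isOctahedralWeb_confocalMap hk hV hVne hVU hinj,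
      fun m l => exists_isOpen_image_eq_inter_webPlane hk hV hVU m l⟩,
    fun m l => ⟨fun μ ha hb hc => isTangentTo_confocalForm hk hac hab m l ha hb hc,
      meetAtAngle_webPlane m l⟩,
    fun l hl s hs => ?_,
    fun ε hε l => ⟨fun s₂ hs hc => ⟨exists_line_asymptoticCurve hk hε l hs hc,
      fun p hp => confocalForm_of_mem_asymptoticCurve hk hac hab hs hc hp⟩,
      isTangentTo_planarMap hk hε l⟩,
    fun s₁ s₃ h3 => tendsto_confocalMap hk s₁ h3⟩
  have hls (m : Fin 4) : l m = webParam m s := by rw [hs, webParam_of_add_eq_add hl]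
  have hmem (h : s ∈ confocalDomain k) (m : Fin 4) : confocalMap k s ∈ webPlane k m (l m) := by
    rw [hls]
    exact confocalMap_mem_webPlane hk h m
  refine ⟨⟨?_, fun h => ⟨confocalMap k s, Set.mem_iInter.2 (hmem h)⟩⟩, fun h =>
    ⟨Set.mem_iInter.2 (hmem h), isVertexOfTouchingCone_of_mem (hmem h), fun hne => ?_⟩⟩
  · rintro ⟨p, hp⟩
    simp only [Set.mem_iInter, hls] at hp
    exact mem_confocalDomain_of_mem_webPlane hk hp
  · refine Set.eq_singleton_iff_unique_mem.2 ⟨Set.mem_iInter.2 (hmem h), fun p hp => ?_⟩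
    simp only [Set.mem_iInter, hls] at hp
    exact eq_of_mem_webPlane hk h hne hp fun m => hls m ▸ hmem h m
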